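/- Let $L,\nu,T>0$, $M_u\ge 0$, $\Omega=(-L,L)$, $X=L^2(\Omega)$, $Y=H^1(\Omega)$, and let $\partial_x$ denote the distributional derivative. Assume the following. * Let $f^0(r)=|r|$, and for $\varepsilon\in(0,1]$ let $f^\varepsilon\in C^2(\mathbb R)$ be convex with $f^\varepsilon\ge 0$, $f^\varepsilon(0)=0$. For every $\varepsilon_0\in[0,1]$, $f^\varepsilon\to f^{\varepsilon_0}$ as $\varepsilon\to\varepsilon_0$, both pointwise and in the sense of Mosco on $\mathbb R$. There is $C_0>0$ with $|(f^\varepsilon)'(r)|\le C_0(1+|r|)$ for all $r\in\mathbb R$, $\varepsilon\in(0,1]$. For every $\lambda>0$, $(f^\varepsilon)''\to0$ uniformly on $\{|r|\ge\lambda\}$ as $\varepsilon\to0$. * $g\in C^1(\mathbb R)$, the function $r\mapsto g(r)+C_g r$ is nondecreasing for a constant $C_g>0$, and $g=G'$ for some $G\in C^2(\mathbb R)$ with $G\ge0$. * Let $\hat K^0=I_{[-1,1]}$ (equal to $0$ on $[-1,1]$ and $+\infty$ elsewhere) and $K^0=\partial I_{[-1,1]}$. For $\delta\in(0,1]$ let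 $\hat K^\delta\in C^2(\mathbb R)$, $K^\delta=(\hat K^\delta)'\in C^1(\mathbb R)$, with $\hat K^\delta=0$ on $[-1,1]$ and $0\le (K^\delta)'\le C_K^\delta$ for some constant $C_K^\delta>0$. For every $\delta_0\in[0,1]$, $\hat K^\delta\to\hat K^{\delta_0}$ in the sense of Mosco on $\mathbb R$ as $\delta\to\delta_0$, and, if $\delta_0>0$, also locally uniformly. * $n\ge 1$ is an integer and $\tau=T/n<\tau^*:=\frac1{8(C_g+1)}$. Let $\varepsilon,\delta\in[0,1]$, $u=[u_1,\dots,u_n]\in X^n$, and let $w_0\in Y$ satisfy $\hat K^\delta(w_0)\in L^1(\Omega)$. A solution of the time-discrete state system $$\tfrac1\tau(w_i-w_{i-1})-\partial_x\bigl(\partial f^\varepsilon(\partial_xw_i)+\nu^2\partial_xw_i\bigr)+K^\delta(w_i)+g(w_i)\ni M_uu_i\ \text{ in }\Omega,\quad \partial_xw_i(\pm L)=0,\qquad i=1,\dots,n,$$ is a $w=[w_1,\dots,w_n]\in Y^n$ such that for each $i$ there are $\varpi_i,\xi_i\in X$ with $\varpi_i\in\partial f^\varepsilon(\partial_xw_i)$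 and $\xi_i\in K^\delta(w_i)$ a.e. in $\Omega$, satisfying, for all $\varphi\in Y$, $$\int_\Omega\Bigl[\bigl(\tfrac1\tau(w_i-w_{i-1})+\xi_i+g(w_i)\bigr)\varphi+(\varpi_i+\nu^2\partial_xw_i)\,\partial_x\varphi\Bigr]dx=\int_\Omega M_uu_i\varphi\,dx .$$ Then the state system has a unique solution $w\in Y^n$, and: 1. $w_i\in H^2(\Omega)$ and $\partial_xw_i(\pm L)=0$ for $i=1,\dots,n$. 2. There are $\varpi^*\in Y^n\cap[L^\infty(\Omega)]^n$ and $\xi\in X^n$ such that, for $i=1,\dots,n$, $$\tfrac1\tau(w_i-w_{i-1})-\partial_x\varpi_i^*-\nu^2\partial_x^2w_i+\xi_i+g(w_i)=M_uu_i\ \text{ in }X,\qquad \varpi_i^*\in\partial f^\varepsilon(\partial_xw_i),\quad \xi_i\in K^\delta(w_i)\ \text{ a.e. in }\Omega.$$ 3. For $i=1,\dots,n$, $$\tfrac1{2\tau}|w_i-w_{i-1}|_X^2+\mathscr F^{(\varepsilon,\delta)}(w_i)-\mathscr F^{(\varepsilon,\delta)}(w_{i-1})\le\tau M_u^2|u_i|_X^2,$$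 where the free energies are finite and, for $z\in X$, $\mathscr F^{(\varepsilon,\delta)}(z)=\Phi^\varepsilon(z)+\int_\Omega\hat K^\delta(z)\,dx+\int_\Omega G(z)\,dx$ if $z\in Y$ and $\mathscr F^{(\varepsilon,\delta)}(z)=+\infty$ otherwise. Here, for $z\in Y$, $\Phi^\varepsilon(z)=\int_\Omega f^\varepsilon(\partial_xz)\,dx+\frac{\nu^2}2\int_\Omega|\partial_xz|^2dx$ if $\varepsilon\in(0,1]$, and $\Phi^0(z)=\sup\{\int_\Omega z\,\partial_x\varphi\,dx : \varphi\in Y\cap C_c(\Omega),\ |\varphi|\le1\}+\frac{\nu^2}2\int_\Omega|\partial_xz|^2dx$. -/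

import Mathlib

open MeasureTheory Filter Topology Set
open scoped ContDiff

namespace AllenCahn

noncomputable section

/-! ### Function spaces on the interval `Ω = (-L, L)` -/

/-- Lebesgue measure on `Ω = (-L, L)`. -/
abbrev vol (L : ℝ) : Measure ℝ := volume.restrict (Ioo (-L) L)

/-- `X = L²(Ω)`. -/
abbrev X (L : ℝ) := Lp ℝ 2 (vol L)

/-- `z'` is the distributional derivative of `z` in `Ω`. -/
def IsWeakDeriv (L : ℝ) (z z' : ℝ → ℝ) : Prop :=
  ∀ φ : ℝ → ℝ, ContDiff ℝ ∞ φ → HasCompactSupport φ → tsupport φ ⊆ Ioo (-L) L →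
    ∫ x, z x * deriv φ x ∂(vol L) = -∫ x, z' x * φ x ∂(vol L)

/-- `z ∈ Y = H¹(Ω)`. -/
def MemH1 {L : ℝ} (z : X L) : Prop := ∃ z' : X L, IsWeakDeriv L z z'

/-- The distributional derivative `∂ₓ z ∈ L²(Ω)` of `z ∈ H¹(Ω)` (and `0` for other `z`). -/
def weakDeriv {L : ℝ} (z : X L) : X L :=
  open Classical in if h : MemH1 z then h.choose else 0

theorem isWeakDeriv_weakDeriv {L : ℝ} {z : X L} (h : MemH1 z) :
    IsWeakDeriv L z (weakDeriv z) := by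
  unfold weakDeriv
  rw [dif_pos h]
  exact h.choose_spec

theorem X_integrable {L : ℝ} (z : X L) : Integrable z (vol L) :=
  (Lp.memLp z).integrable (by norm_num)

/-- The distributional derivative is unique. -/
theorem IsWeakDeriv.unique {L : ℝ} {z : ℝ → ℝ} {p q : X L}
    (hp : IsWeakDeriv L z p) (hq : IsWeakDeriv L z q) : p = q := by
  have hd : Integrable (fun x => p x - q x) (vol L) := (X_integrable p).sub (X_integrable q)
  have key : ∀ᵐ x ∂(volume : Measure ℝ), x ∈ Ioo (-L) L → p x - q x = 0 := by
    refine isOpen_Ioo.ae_eq_zero_of_integral_contDiff_smul_eq_zero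
      (IntegrableOn.locallyIntegrableOn hd) ?_
    intro φ hφ hc hs
    have hb : ∀ r : X L, Integrable (fun x => r x * φ x) (vol L) := by
      intro r
      obtain ⟨C, hC⟩ := hc.exists_bound_of_continuous hφ.continuous
      exact (X_integrable r).mul_bdd (c := C) hφ.continuous.aestronglyMeasurable
        (Eventually.of_forall hC)
    have h1 : ∫ x, p x * φ x ∂(vol L) = ∫ x, q x * φ x ∂(vol L) := by
      have := (hp φ hφ hc hs).symm.trans (hq φ hφ hc hs)
      linarith
    have h2 : ∫ x, φ x • (p x - q x) ∂(vol L) = 0 := by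
      have : (fun x => φ x • (p x - q x)) = fun x => p x * φ x - q x * φ x := by
        funext x; simp only [smul_eq_mul]; ring
      rw [this, integral_sub (hb p) (hb q), h1, sub_self]
    rw [← h2]
    refine (setIntegral_eq_integral_of_forall_compl_eq_zero ?_).symm
    intro x hx
    have : φ x = 0 := by
      by_contra hne
      exact hx (hs (subset_tsupport φ hne))
    simp [this]
  apply Lp.ext
  have := (ae_restrict_iff' (μ := volume) measurableSet_Ioo).2 key
  filter_upwards [this] with x hx
  linarith

/-- `z ∈ H²(Ω)`. -/
def MemH2 {L : ℝ} (z : X L) : Prop := MemH1 z ∧ MemH1 (weakDeriv z)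

/-- `z(±L) = 0`, read on the representative of `z` that is continuous on `[-L, L]`. -/
def VanishesAtBoundary {L : ℝ} (z : X L) : Prop :=
  ∃ q : ℝ → ℝ, ContinuousOn q (Icc (-L) L) ∧ (∀ᵐ x ∂(vol L), z x = q x) ∧
    q (-L) = 0 ∧ q L = 0

/-! ### Convex analysis -/

/-- The subdifferential of `ψ : H → (-∞, ∞]` at `z`. -/
def subdiff {H : Type*} [NormedAddCommGroup H] [InnerProductSpace ℝ H]
    (ψ : H → EReal) (z : H) : Set H :=
  {z' | ψ z ≠ ⊤ ∧ ∀ y : H, ((inner ℝ z' (y - z) : ℝ) : EReal) + ψ z ≤ ψ y}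

/-- Mosco convergence `ψₙ → ψ` on a Hilbert space `H`. -/
structure MoscoTendsto {H : Type*} [NormedAddCommGroup H] [InnerProductSpace ℝ H]
    (ψn : ℕ → H → EReal) (ψ : H → EReal) : Prop where
  /-- lower bound along weakly convergent sequences -/
  lower_bound : ∀ (w : H) (wn : ℕ → H),
    (∀ y : H, Tendsto (fun n => (inner ℝ (wn n) y : ℝ)) atTop (𝓝 (inner ℝ w y))) →
      ψ w ≤ liminf (fun n => ψn n (wn n)) atTop
  /-- existence of strongly convergent recovery sequences -/
  optimality : ∀ w : H, ψ w ≠ ⊤ → ∃ wn : ℕ → H,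
    Tendsto wn atTop (𝓝 w) ∧ Tendsto (fun n => ψn n (wn n)) atTop (𝓝 (ψ w))

/-- Mosco convergence `ψ^ε → ψ^{ε₀}` as `ε → ε₀` inside the parameter set `Λ`. -/
def MoscoTendstoWithin {H : Type*} [NormedAddCommGroup H] [InnerProductSpace ℝ H]
    (ψ : ℝ → H → EReal) (Λ : Set ℝ) (ε₀ : ℝ) : Prop :=
  ∀ s : ℕ → ℝ, (∀ m, s m ∈ Λ) → Tendsto s atTop (𝓝 ε₀) →
    MoscoTendsto (fun m => ψ (s m)) (ψ ε₀)

/-- The indicator function `I_{[-1,1]}` of convex analysis. -/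
def indicatorI (r : ℝ) : EReal := open Classical in if r ∈ Icc (-1 : ℝ) 1 then 0 else ⊤

/-! ### The data -/

/-- The regularizations `f^ε`, `ε ∈ (0, 1]`, of `f⁰ = |·|`. -/
structure IsRegularizationAbs (f : ℝ → ℝ → ℝ) : Prop where
  zero : ∀ r, f 0 r = |r|
  contDiff : ∀ ε ∈ Ioc (0 : ℝ) 1, ContDiff ℝ 2 (f ε)
  convex : ∀ ε ∈ Ioc (0 : ℝ) 1, ConvexOn ℝ univ (f ε)
  map_zero : ∀ ε ∈ Ioc (0 : ℝ) 1, f ε 0 = 0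
  nonneg : ∀ ε ∈ Ioc (0 : ℝ) 1, ∀ r, 0 ≤ f ε r
  pointwise : ∀ ε₀ ∈ Icc (0 : ℝ) 1, ∀ r,
    Tendsto (fun ε => f ε r) (𝓝[Icc 0 1] ε₀) (𝓝 (f ε₀ r))
  mosco : ∀ ε₀ ∈ Icc (0 : ℝ) 1,
    MoscoTendstoWithin (fun ε (r : ℝ) => ((f ε r : ℝ) : EReal)) (Icc 0 1) ε₀
  deriv_bound : ∃ C₀ > 0, ∀ ε ∈ Ioc (0 : ℝ) 1, ∀ r, |deriv (f ε) r| ≤ C₀ * (1 + |r|)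
  deriv2_tendsto : ∀ lam > 0,
    TendstoUniformlyOn (fun ε => deriv (deriv (f ε))) (fun _ => 0) (𝓝[>] 0) {r | lam ≤ |r|}

/-- The semi-monotone perturbation `g`, with constant `Cg`, and its primitive `G ≥ 0`. -/
structure IsPerturbation (g G : ℝ → ℝ) (Cg : ℝ) : Prop where
  contDiff_g : ContDiff ℝ 1 g
  Cg_pos : 0 < Cg
  semimonotone : Monotone fun r => g r + Cg * r
  contDiff_G : ContDiff ℝ 2 G
  G_nonneg : ∀ r, 0 ≤ G r
  hasDerivAt : ∀ r, HasDerivAt G (g r) r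

/-- The extended-real function `K̂^δ`: it is `I_{[-1,1]}` for `δ = 0` and the given real function
`Kh δ` otherwise. -/
def KhatE (Kh : ℝ → ℝ → ℝ) (δ : ℝ) (r : ℝ) : EReal :=
  open Classical in if δ = 0 then indicatorI r else ((Kh δ r : ℝ) : EReal)

/-- The set-valued function `K^δ`: it is `∂I_{[-1,1]}` for `δ = 0` and single-valued otherwise. -/
def Kset (K : ℝ → ℝ → ℝ) (δ : ℝ) (r : ℝ) : Set ℝ :=
  open Classical in if δ = 0 then subdiff indicatorI r else {K δ r}

/-- The approximations `K̂^δ` (here `Kh δ`) and `K^δ = (K̂^δ)'`, `δ ∈ (0, 1]`, of `I_{[-1,1]}` and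
`∂I_{[-1,1]}`. -/
structure IsRegularizationIndicator (Kh K : ℝ → ℝ → ℝ) : Prop where
  contDiff_Kh : ∀ δ ∈ Ioc (0 : ℝ) 1, ContDiff ℝ 2 (Kh δ)
  contDiff_K : ∀ δ ∈ Ioc (0 : ℝ) 1, ContDiff ℝ 1 (K δ)
  hasDerivAt : ∀ δ ∈ Ioc (0 : ℝ) 1, ∀ r, HasDerivAt (Kh δ) (K δ r) r
  eq_zero : ∀ δ ∈ Ioc (0 : ℝ) 1, ∀ r ∈ Icc (-1 : ℝ) 1, Kh δ r = 0
  deriv_bound : ∀ δ ∈ Ioc (0 : ℝ) 1, ∃ C > 0, ∀ r, 0 ≤ deriv (K δ) r ∧ deriv (K δ) r ≤ C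
  mosco : ∀ δ₀ ∈ Icc (0 : ℝ) 1, MoscoTendstoWithin (KhatE Kh) (Icc 0 1) δ₀
  locallyUniform : ∀ δ₀ ∈ Ioc (0 : ℝ) 1,
    TendstoLocallyUniformly Kh (Kh δ₀) (𝓝[Ioc 0 1] δ₀)

/-! ### Energies -/

/-- `h(z) ∈ L¹(Ω)` for an extended-real function `h`. -/
def InL1 {L : ℝ} (h : ℝ → EReal) (z : X L) : Prop :=
  (∀ᵐ x ∂(vol L), h (z x) ≠ ⊤ ∧ h (z x) ≠ ⊥) ∧
    Integrable (fun x => (h (z x)).toReal) (vol L)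

/-- `∫_Ω h(z) dx` for a function `h ≥ 0`: it is `∞` unless `h(z) ∈ L¹(Ω)`. -/
def intFunctional {L : ℝ} (h : ℝ → EReal) (z : X L) : EReal :=
  open Classical in
    if InL1 h z then ((∫ x, (h (z x)).toReal ∂(vol L) : ℝ) : EReal) else ⊤

/-- The total variation `V⁰(z) = sup { ∫ z ∂ₓφ | φ ∈ H¹(Ω) ∩ C_c(Ω), |φ| ≤ 1 }`. -/
def V0 {L : ℝ} (z : X L) : EReal :=
  sSup {a : EReal | ∃ (φ : ℝ → ℝ) (φ' : X L), Continuous φ ∧ HasCompactSupport φ ∧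
    tsupport φ ⊆ Ioo (-L) L ∧ (∀ x, |φ x| ≤ 1) ∧ IsWeakDeriv L φ φ' ∧
    a = ((∫ x, z x * φ' x ∂(vol L) : ℝ) : EReal)}

/-- The Dirichlet part `V^D(z) = (ν²/2) ∫ |∂ₓz|²`, which is `∞` off `H¹(Ω)`. -/
def VD {L : ℝ} (ν : ℝ) (z : X L) : EReal :=
  open Classical in
    if MemH1 z then ((ν ^ 2 / 2 * ∫ x, (weakDeriv z x) ^ 2 ∂(vol L) : ℝ) : EReal) else ⊤

/-- The convex energy `Φ^ε`. -/
def Phi {L : ℝ} (ν : ℝ) (f : ℝ → ℝ → ℝ) (ε : ℝ) (z : X L) : EReal :=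
  open Classical in
    if ε = 0 then V0 z + VD ν z
    else if MemH1 z then
      intFunctional (fun r => ((f ε r : ℝ) : EReal)) (weakDeriv z)
        + ((ν ^ 2 / 2 * ∫ x, (weakDeriv z x) ^ 2 ∂(vol L) : ℝ) : EReal)
    else ⊤

/-- The convex energy `Ψ^{(ε,δ)}`. -/
def Psi {L : ℝ} (ν : ℝ) (f Kh : ℝ → ℝ → ℝ) (ε δ : ℝ) (z : X L) : EReal :=
  open Classical in
    if MemH1 z then Phi ν f ε z + intFunctional (KhatE Kh δ) z else ⊤

/-- The free energy `𝓕^{(ε,δ)}(z) = Ψ^{(ε,δ)}(z) + ∫ G(z) dx`. -/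
def freeEnergy {L : ℝ} (ν : ℝ) (f Kh : ℝ → ℝ → ℝ) (G : ℝ → ℝ) (ε δ : ℝ) (z : X L) : EReal :=
  Psi ν f Kh ε δ z + intFunctional (fun r => ((G r : ℝ) : EReal)) z

/-! ### The state system -/

/-- `prev w₀ w i` is the predecessor `w_{i-1}` of `w_i` in `w₀, w₁, …, w_n`, where the steps
`i = 1, …, n` are indexed by `Fin n`. -/
def prev {L : ℝ} {n : ℕ} (w₀ : X L) (w : Fin n → X L) (i : Fin n) : X L :=
  (Fin.cons w₀ w : Fin (n + 1) → X L) i.castSucc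

/-- `w = [w₁, …, w_n]`, with `w_i ∈ H¹(Ω)`, is a solution of the time-discrete state system
`(w_i - w_{i-1})/τ - ∂ₓ(∂f^ε(∂ₓw_i) + ν² ∂ₓw_i) + K^δ(w_i) + g(w_i) ∋ M_u u_i` in `Ω` with homogeneous
Neumann boundary condition. There are selections `ϖ ∈ ∂f^ε(∂ₓw_i)` and `ξ ∈ K^δ(w_i)` in `L²(Ω)`
for which the equation holds weakly; as the test functions range over all of `H¹(Ω)`, the flux
`ϖ + ν² ∂ₓw_i` vanishes at `±L`. -/
def IsSolution {L : ℝ} {n : ℕ} (τ ν Mu : ℝ) (f K : ℝ → ℝ → ℝ) (g : ℝ → ℝ) (ε δ : ℝ)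
    (u : Fin n → X L) (w₀ : X L) (w : Fin n → X L) : Prop :=
  ∀ i : Fin n, MemH1 (w i) ∧ ∃ ϖ ξ : X L,
    (∀ᵐ x ∂(vol L), ϖ x ∈ subdiff (fun r : ℝ => ((f ε r : ℝ) : EReal)) (weakDeriv (w i) x)) ∧
    (∀ᵐ x ∂(vol L), ξ x ∈ Kset K δ (w i x)) ∧
    ∀ φ : X L, MemH1 φ →
      ∫ x, ((1 / τ * (w i x - prev w₀ w i x) + ξ x + g (w i x)) * φ x
        + (ϖ x + ν ^ 2 * weakDeriv (w i) x) * weakDeriv φ x) ∂(vol L)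
        = ∫ x, Mu * u i x * φ x ∂(vol L)

end

end AllenCahn

namespace AllenCahn

noncomputable section

/-! The scheme decouples into `n` stationary problems, each solved in dual form. With `v` the
predecessor, put `h = v/τ + M_u u`, let `s` be the selection of `K^δ(w) + w/τ + g(w)` given by the
equation, and let `p = ϖ + ν² ∂ₓw` be the flux. The equation with its boundary condition says `p' =
s - h`, `p(±L) = 0`: thus `s - h` has mean zero and `p` is its primitive from `-L`. Since `C_g <
1/τ`, the map `r ↦ r/τ + g(r)` is strongly monotone, so the resolvents `R = (K^δ + 1/τ + g)⁻¹` and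
`J = (∂f^ε + ν²)⁻¹` are single-valued, nondecreasing and Lipschitz, and `J 0 = 0`. The multivalued
problem becomes `w = R(s)`, `∂ₓw = J(p)`, that is, a Lipschitz monotone equation for `s`, tested
against functions of mean zero.

This equation need not be coercive in `s`. Adding `η s` makes it strongly monotone, hence solvable
by a contraction (`exists_regularized_solution`). Integration by parts and the signs of `J` and `R`
give `‖s‖ ≤ ‖h‖` uniformly in `η` (`norm_le_of_isWeakDeriv`), and the argument of Crandall and Pazy
upgrades this bound to strong convergence as `η → 0` (`cauchySeq_of_crandall_pazy`).

Regularity follows from `∂ₓw = J(p)` with `p` absolutely continuous and zero at `±L`. Uniqueness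
comes from testing the difference of two solutions with itself, and the energy inequality from
testing with `w - v`, by convexity of `f^ε`, `K̂^δ` and `G + C_g r²/2`. For `ε = 0` the energy is a
supremum over test functions, which `V0_eq` identifies with `∫ |∂ₓw|`. -/

/-! ### Scalar subdifferentials and resolvents -/

theorem mem_subdiff_coe_iff {φ : ℝ → ℝ} {p z : ℝ} :
    p ∈ subdiff (fun r : ℝ => ((φ r : ℝ) : EReal)) z ↔ ∀ y, p * (y - z) + φ z ≤ φ y := by
  have hin : ∀ y, (inner ℝ p (y - z) : ℝ) = p * (y - z) := fun y => by simp [mul_comm]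
  simp only [subdiff, mem_ofPred_eq, hin]
  constructor
  · intro h y
    exact_mod_cast h.2 y
  · intro h
    refine ⟨EReal.coe_ne_top _, fun y => ?_⟩
    exact_mod_cast h y

theorem mem_subdiff_indicatorI_iff {p z : ℝ} :
    p ∈ subdiff indicatorI z ↔
      z ∈ Icc (-1 : ℝ) 1 ∧ ∀ y ∈ Icc (-1 : ℝ) 1, p * (y - z) ≤ 0 := by
  have hin : ∀ y, (inner ℝ p (y - z) : ℝ) = p * (y - z) := fun y => by simp [mul_comm]
  simp only [subdiff, mem_ofPred_eq, hin]
  constructor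
  · rintro ⟨h1, h2⟩
    have hz : z ∈ Icc (-1 : ℝ) 1 := by
      by_contra h
      exact h1 (by rw [indicatorI, if_neg h])
    refine ⟨hz, fun y hy => ?_⟩
    have := h2 y
    rw [indicatorI, indicatorI, if_pos hz, if_pos hy, add_zero] at this
    exact_mod_cast this
  · rintro ⟨h1, h2⟩
    refine ⟨by rw [indicatorI, if_pos h1]; exact EReal.zero_ne_top, fun y => ?_⟩
    rw [indicatorI, indicatorI, if_pos h1, add_zero]
    split_ifs with hy
    · exact_mod_cast h2 y hy
    · exact le_top

theorem subdiff_coe_monotone {φ : ℝ → ℝ} {p q x y : ℝ}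
    (hp : p ∈ subdiff (fun r : ℝ => ((φ r : ℝ) : EReal)) x)
    (hq : q ∈ subdiff (fun r : ℝ => ((φ r : ℝ) : EReal)) y) : 0 ≤ (p - q) * (x - y) := by
  have h1 := mem_subdiff_coe_iff.1 hp y
  have h2 := mem_subdiff_coe_iff.1 hq x
  linarith

/-- A differentiable convex function lies above its tangents. -/
theorem tangent_le_of_convexOn {φ : ℝ → ℝ} (hφ : ConvexOn ℝ univ φ) {d x : ℝ}
    (hd : HasDerivAt φ d x) (y : ℝ) : d * (y - x) + φ x ≤ φ y := by
  rcases lt_trichotomy x y with h | h | h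
  · have := hφ.le_slope_of_hasDerivAt (mem_univ x) (mem_univ y) h hd
    rw [slope_def_field, le_div_iff₀ (by linarith)] at this
    linarith
  · subst h; simp
  · have := hφ.slope_le_of_hasDerivAt (mem_univ y) (mem_univ x) h hd
    rw [slope_def_field, div_le_iff₀ (by linarith)] at this
    linarith

/-- The resolvent of a convex function: `p - m r ∈ ∂φ(r)` is solvable for every `p`. -/
theorem exists_sub_mul_mem_subdiff {φ : ℝ → ℝ} (hφ : ConvexOn ℝ univ φ) (hc : Continuous φ)
    (h0 : ∀ r, 0 ≤ φ r) {m : ℝ} (hm : 0 < m) (p : ℝ) :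
    ∃ r, p - m * r ∈ subdiff (fun r : ℝ => ((φ r : ℝ) : EReal)) r := by
  -- The optimality condition of this minimization problem is `p - m r ∈ ∂φ(r)`.
  obtain ⟨r, hr⟩ : ∃ r, ∀ y, φ r + m / 2 * r ^ 2 - p * r ≤ φ y + m / 2 * y ^ 2 - p * y := by
    refine Continuous.exists_forall_le (by fun_prop) ?_
    have h1 : Tendsto (fun y : ℝ => m / 4 * ‖y‖ ^ 2 - p ^ 2 / m) (cocompact ℝ) atTop := by
      refine tendsto_atTop_add_const_right _ _ (Tendsto.const_mul_atTop (by positivity) ?_)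
      exact (tendsto_pow_atTop two_ne_zero).comp tendsto_norm_cocompact_atTop
    refine tendsto_atTop_mono (fun y => ?_) h1
    have h2 : 0 ≤ m / 4 * (y - 2 * p / m) ^ 2 := by positivity
    have h3 : m / 4 * (y - 2 * p / m) ^ 2 = m / 4 * y ^ 2 - p * y + p ^ 2 / m := by
      field_simp; ring
    rw [Real.norm_eq_abs, sq_abs]
    linarith [h0 y]
  refine ⟨r, mem_subdiff_coe_iff.2 fun y => ?_⟩
  -- Minimality is compared at `(1 - t) r + t y`; after convexity and division by `t`, the quadratic
  -- term leaves an error of order `t`.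
  have key : ∀ t ∈ Ioo (0 : ℝ) 1,
      (p - m * r) * (y - r) + φ r ≤ φ y + t * (m / 2 * (y - r) ^ 2) := by
    rintro t ⟨ht0, ht1⟩
    have h1 := hr ((1 - t) * r + t * y)
    have h2 := hφ.2 (mem_univ r) (mem_univ y) (sub_nonneg.2 ht1.le) ht0.le (by ring)
    simp only [smul_eq_mul] at h2
    have h3 : t * ((p - m * r) * (y - r) + φ r) ≤ t * (φ y + t * (m / 2 * (y - r) ^ 2)) := by
      nlinarith
    exact le_of_mul_le_mul_left h3 ht0
  have hl : Tendsto (fun t : ℝ => φ y + t * (m / 2 * (y - r) ^ 2)) (𝓝[>] 0)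
      (𝓝 (φ y + 0 * (m / 2 * (y - r) ^ 2))) :=
    ((continuous_const.add (continuous_id.mul continuous_const)).tendsto 0).mono_left
      nhdsWithin_le_nhds
  rw [zero_mul, add_zero] at hl
  refine ge_of_tendsto hl ?_
  filter_upwards [Ioo_mem_nhdsGT one_pos] with t ht using key t ht

/-- A selection of the inverse of a strongly monotone relation is monotone and Lipschitz. -/
theorem monotone_lipschitz_of_strongly_monotone {R : ℝ → ℝ} {c : ℝ} (hc : 0 < c)
    (h : ∀ s t, c * (R s - R t) ^ 2 ≤ (s - t) * (R s - R t)) :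
    Monotone R ∧ LipschitzWith (c⁻¹).toNNReal R := by
  constructor
  · intro s t hst
    by_contra! hlt
    have h1 := h s t
    have h2 : 0 < (R s - R t) ^ 2 := by have := sub_pos.2 hlt; positivity
    have h3 : (s - t) * (R s - R t) ≤ 0 :=
      mul_nonpos_of_nonpos_of_nonneg (by linarith) (by linarith)
    nlinarith
  · refine LipschitzWith.of_dist_le_mul fun s t => ?_
    rw [Real.coe_toNNReal _ (inv_nonneg.2 hc.le), Real.dist_eq, Real.dist_eq, inv_mul_eq_div,
      le_div_iff₀ hc]
    by_cases h0 : |R s - R t| = 0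
    · rw [h0]; simp
    · have hpos : 0 < |R s - R t| := lt_of_le_of_ne (abs_nonneg _) (Ne.symm h0)
      have h1 := h s t
      have h2 : (s - t) * (R s - R t) ≤ |s - t| * |R s - R t| := by
        rw [← abs_mul]; exact le_abs_self _
      rw [← sq_abs] at h1
      have h3 : (|R s - R t| * c) * |R s - R t| ≤ |s - t| * |R s - R t| := by nlinarith
      exact le_of_mul_le_mul_right h3 hpos

/-- A continuous strongly monotone function on `ℝ` is onto. -/
theorem surjective_of_strongly_monotone {b : ℝ → ℝ} (hb : Continuous b) {c : ℝ} (hc : 0 < c)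
    (h : ∀ x y, c * (x - y) ^ 2 ≤ (b x - b y) * (x - y)) : Function.Surjective b := by
  have e1 : ∀ x > 0, b 0 + c * x ≤ b x := fun x hx => by
    have := h x 0
    have h3 : c * x * x ≤ (b x - b 0) * x := by nlinarith
    linarith [le_of_mul_le_mul_right h3 hx]
  have e2 : ∀ x < 0, b x ≤ b 0 + c * x := fun x hx => by
    have := h x 0
    have h3 : (b x - b 0) * (-x) ≤ c * x * (-x) := by nlinarith
    linarith [le_of_mul_le_mul_right h3 (neg_pos.2 hx)]
  refine hb.surjective ?_ ?_
  · refine tendsto_atTop_mono' _ ?_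
      (tendsto_atTop_add_const_left _ (b 0) (tendsto_id.const_mul_atTop hc))
    filter_upwards [eventually_gt_atTop 0] with x hx using e1 x hx
  · refine tendsto_atBot_mono' _ ?_
      (tendsto_atBot_add_const_left _ (b 0) (tendsto_id.const_mul_atBot hc))
    filter_upwards [eventually_lt_atBot 0] with x hx using e2 x hx

/-! ### The functions `f^ε` and their resolvents -/

section Regularization

variable {f : ℝ → ℝ → ℝ} {ε : ℝ}

theorem IsRegularizationAbs.convexOn (hf : IsRegularizationAbs f) (hε : ε ∈ Icc (0 : ℝ) 1) :
    ConvexOn ℝ univ (f ε) := by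
  rcases hε.1.eq_or_lt with rfl | h
  · have : f 0 = fun r => ‖r‖ := funext hf.zero
    rw [this]; exact convexOn_norm convex_univ
  · exact hf.convex ε ⟨h, hε.2⟩

theorem IsRegularizationAbs.continuous (hf : IsRegularizationAbs f) (hε : ε ∈ Icc (0 : ℝ) 1) :
    Continuous (f ε) := by
  rcases hε.1.eq_or_lt with rfl | h
  · have : f 0 = fun r => |r| := funext hf.zero
    rw [this]; exact continuous_abs
  · exact (hf.contDiff ε ⟨h, hε.2⟩).continuous

theorem IsRegularizationAbs.apply_zero (hf : IsRegularizationAbs f) (hε : ε ∈ Icc (0 : ℝ) 1) :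
    f ε 0 = 0 := by
  rcases hε.1.eq_or_lt with rfl | h
  · rw [hf.zero, abs_zero]
  · exact hf.map_zero ε ⟨h, hε.2⟩

theorem IsRegularizationAbs.apply_nonneg (hf : IsRegularizationAbs f) (hε : ε ∈ Icc (0 : ℝ) 1)
    (r : ℝ) : 0 ≤ f ε r := by
  rcases hε.1.eq_or_lt with rfl | h
  · rw [hf.zero]; exact abs_nonneg r
  · exact hf.nonneg ε ⟨h, hε.2⟩ r

/-- The tangent at `r`, evaluated at `0`, gives `f(r) ≤ f'(r) r`, so linear growth of `f'` suffices.
This makes `f^ε(∂ₓz)` integrable for every `z ∈ H¹(Ω)`. -/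
theorem IsRegularizationAbs.quadratic_growth (hf : IsRegularizationAbs f)
    (hε : ε ∈ Icc (0 : ℝ) 1) : ∃ C, ∀ r, f ε r ≤ C * (1 + r ^ 2) := by
  rcases hε.1.eq_or_lt with rfl | h
  · refine ⟨1, fun r => ?_⟩
    rw [hf.zero]
    nlinarith [sq_nonneg (|r| - 1), sq_abs r]
  · obtain ⟨C, hC, hb⟩ := hf.deriv_bound
    refine ⟨2 * C, fun r => ?_⟩
    have hd : HasDerivAt (f ε) (deriv (f ε) r) r :=
      ((hf.contDiff ε ⟨h, hε.2⟩).differentiable (by norm_num) r).hasDerivAt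
    have h1 := tangent_le_of_convexOn (hf.convexOn hε) hd 0
    rw [hf.apply_zero hε] at h1
    have h2 : deriv (f ε) r * r ≤ |deriv (f ε) r| * |r| := by
      rw [← abs_mul]; exact le_abs_self _
    have h3 : |deriv (f ε) r| * |r| ≤ C * (1 + |r|) * |r| :=
      mul_le_mul_of_nonneg_right (hb ε ⟨h, hε.2⟩ r) (abs_nonneg r)
    have h4 : (1 + |r|) * |r| ≤ 2 * (1 + r ^ 2) := by
      nlinarith [sq_nonneg (|r| - 1), sq_abs r]
    nlinarith

/-- The resolvent `(∂f^ε + m)⁻¹`. -/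
theorem IsRegularizationAbs.exists_resolvent (hf : IsRegularizationAbs f)
    (hε : ε ∈ Icc (0 : ℝ) 1) {m : ℝ} (hm : 0 < m) :
    ∃ J : ℝ → ℝ, J 0 = 0 ∧ Monotone J ∧ (∃ C, LipschitzWith C J) ∧
      (∀ p, p - m * J p ∈ subdiff (fun r : ℝ => ((f ε r : ℝ) : EReal)) (J p)) ∧
      ∀ p r, p - m * r ∈ subdiff (fun r : ℝ => ((f ε r : ℝ) : EReal)) r → r = J p := by
  choose J hJ using exists_sub_mul_mem_subdiff (hf.convexOn hε) (hf.continuous hε)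
    (hf.apply_nonneg hε) hm
  have huniq : ∀ p r, p - m * r ∈ subdiff (fun r : ℝ => ((f ε r : ℝ) : EReal)) r → r = J p := by
    intro p r hr
    have h1 := subdiff_coe_monotone hr (hJ p)
    have h2 : m * (r - J p) ^ 2 ≤ 0 := by nlinarith
    have h3 : (r - J p) ^ 2 ≤ 0 := by
      by_contra! h; nlinarith
    nlinarith [pow_eq_zero_iff (two_ne_zero) |>.1 (le_antisymm h3 (sq_nonneg _))]
  have hml := monotone_lipschitz_of_strongly_monotone (R := J) hm fun s t => by
    have := subdiff_coe_monotone (hJ s) (hJ t)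
    nlinarith
  refine ⟨J, ?_, hml.1, ⟨_, hml.2⟩, hJ, huniq⟩
  refine (huniq 0 0 (mem_subdiff_coe_iff.2 fun y => ?_)).symm
  simpa [hf.apply_zero hε] using hf.apply_nonneg hε y

end Regularization

/-! ### The graphs `K^δ` and the resolvents of their strongly monotone perturbations -/

section Indicator

variable {Kh K : ℝ → ℝ → ℝ} {δ : ℝ}

theorem IsRegularizationIndicator.monotone (hK : IsRegularizationIndicator Kh K)
    (hδ : δ ∈ Ioc (0 : ℝ) 1) : Monotone (K δ) := by
  obtain ⟨C, _, hC⟩ := hK.deriv_bound δ hδ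
  exact monotone_of_deriv_nonneg ((hK.contDiff_K δ hδ).differentiable (by norm_num))
    fun r => (hC r).1

theorem IsRegularizationIndicator.convexOn (hK : IsRegularizationIndicator Kh K)
    (hδ : δ ∈ Ioc (0 : ℝ) 1) : ConvexOn ℝ univ (Kh δ) := by
  have hd : deriv (Kh δ) = K δ := funext fun r => (hK.hasDerivAt δ hδ r).deriv
  refine Monotone.convexOn_univ_of_deriv
    (fun r => (hK.hasDerivAt δ hδ r).differentiableAt) ?_
  rw [hd]; exact hK.monotone hδ

theorem Kset_of_pos (hδ : δ ∈ Ioc (0 : ℝ) 1) (r : ℝ) : Kset K δ r = {K δ r} := by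
  rw [Kset, if_neg hδ.1.ne']

theorem Kset_zero (r : ℝ) : Kset K 0 r = subdiff indicatorI r := by rw [Kset, if_pos rfl]

theorem Kset_monotone (hK : IsRegularizationIndicator Kh K) (hδ : δ ∈ Icc (0 : ℝ) 1)
    {p q x y : ℝ} (hp : p ∈ Kset K δ x) (hq : q ∈ Kset K δ y) : 0 ≤ (p - q) * (x - y) := by
  rcases hδ.1.eq_or_lt with rfl | h
  · rw [Kset_zero, mem_subdiff_indicatorI_iff] at hp hq
    have h1 := hp.2 y hq.1
    have h2 := hq.2 x hp.1
    linarith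
  · have hδ' : δ ∈ Ioc (0 : ℝ) 1 := ⟨h, hδ.2⟩
    rw [Kset_of_pos hδ', mem_singleton_iff] at hp hq
    rw [hp, hq]
    rcases le_total x y with hxy | hxy
    · exact mul_nonneg_of_nonpos_of_nonpos (sub_nonpos.2 (hK.monotone hδ' hxy))
        (sub_nonpos.2 hxy)
    · exact mul_nonneg (sub_nonneg.2 (hK.monotone hδ' hxy)) (sub_nonneg.2 hxy)

/-- The resolvent `(K^δ + b)⁻¹` for a continuous strongly monotone function `b`. -/
theorem IsRegularizationIndicator.exists_resolvent (hK : IsRegularizationIndicator Kh K)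
    (hδ : δ ∈ Icc (0 : ℝ) 1) {b : ℝ → ℝ} (hb : Continuous b) {c : ℝ} (hc : 0 < c)
    (h : ∀ x y, c * (x - y) ^ 2 ≤ (b x - b y) * (x - y)) :
    ∃ R : ℝ → ℝ, Monotone R ∧ (∃ C, LipschitzWith C R) ∧ ∀ s, s - b (R s) ∈ Kset K δ (R s) := by
  have hex : ∀ s, ∃ r, s - b r ∈ Kset K δ r := by
    intro s
    rcases hδ.1.eq_or_lt with rfl | hpos
    · simp only [Kset_zero, mem_subdiff_indicatorI_iff]
      -- For `δ = 0` the solution is `b⁻¹(s)` truncated to `[-1, 1]`; at an end point the residual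
      -- `s - b r` lies in the normal cone.
      rcases le_total s (b (-1)) with h1 | h1
      · exact ⟨-1, by norm_num, fun y hy =>
          mul_nonpos_of_nonpos_of_nonneg (by linarith) (by linarith [hy.1])⟩
      rcases le_total (b 1) s with h2 | h2
      · exact ⟨1, by norm_num, fun y hy =>
          mul_nonpos_of_nonneg_of_nonpos (by linarith) (by linarith [hy.2])⟩
      obtain ⟨r, hr, hrs⟩ := intermediate_value_Icc (by norm_num : (-1 : ℝ) ≤ 1)
        hb.continuousOn ⟨h1, h2⟩
      exact ⟨r, hr, fun y _ => by rw [hrs]; simp⟩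
    · have hδ' : δ ∈ Ioc (0 : ℝ) 1 := ⟨hpos, hδ.2⟩
      obtain ⟨r, hr⟩ := surjective_of_strongly_monotone
        ((hK.contDiff_K δ hδ').continuous.add hb) hc (fun x y => by
          have h1 := Kset_monotone hK hδ (p := K δ x) (q := K δ y) (x := x) (y := y)
            (by rw [Kset_of_pos hδ']; rfl) (by rw [Kset_of_pos hδ']; rfl)
          have h2 := h x y
          simp only [Pi.add_apply]
          linarith) s
      refine ⟨r, ?_⟩
      rw [Kset_of_pos hδ', mem_singleton_iff]
      simp only [Pi.add_apply] at hr
      linarith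
  choose R hR using hex
  have hml := monotone_lipschitz_of_strongly_monotone (R := R) hc fun s t => by
    have h1 := Kset_monotone hK hδ (hR s) (hR t)
    have h2 := h (R s) (R t)
    linarith
  exact ⟨R, hml.1, ⟨_, hml.2⟩, hR⟩

end Indicator

/-! ### Composition of absolutely continuous functions with Lipschitz functions -/

section AbsolutelyContinuous

variable {F : ℝ → ℝ} {a b : ℝ}

theorem absolutelyContinuousOnInterval_comp {Φ : ℝ → ℝ} {C : NNReal} (hΦ : LipschitzWith C Φ)
    (hF : AbsolutelyContinuousOnInterval F a b) :
    AbsolutelyContinuousOnInterval (fun x => Φ (F x)) a b := by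
  have h := Tendsto.const_mul (C : ℝ) hF
  rw [mul_zero] at h
  refine squeeze_zero (fun E => Finset.sum_nonneg fun i _ => dist_nonneg) (fun E => ?_) h
  rw [Finset.mul_sum]
  exact Finset.sum_le_sum fun i _ => hΦ.dist_le_mul _ _

theorem absolutelyContinuousOnInterval_const (c : ℝ) :
    AbsolutelyContinuousOnInterval (fun _ => c) a b :=
  (LipschitzWith.const c).lipschitzOnWith.absolutelyContinuousOnInterval

/-- Difference quotients replace the chain rule, as `Φ` need not be differentiable. Where the
composition has no derivative, `deriv` is `0` and the bound is trivial. -/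
theorem abs_deriv_comp_le {Φ : ℝ → ℝ} {C : NNReal} (hΦ : LipschitzWith C Φ) {x : ℝ}
    (hF : DifferentiableAt ℝ F x) : |deriv (fun x => Φ (F x)) x| ≤ C * |deriv F x| := by
  have key : ∀ e > 0, |deriv (fun x => Φ (F x)) x| ≤ C * (|deriv F x| + e) := by
    intro e he
    rw [← Real.norm_eq_abs]
    refine norm_deriv_le_of_lip' (by positivity) ?_
    filter_upwards [hF.hasDerivAt.isLittleO.def he] with y hy
    have h1 : ‖Φ (F y) - Φ (F x)‖ ≤ C * ‖F y - F x‖ := by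
      simpa [dist_eq_norm] using hΦ.dist_le_mul (F y) (F x)
    have h2 : ‖F y - F x‖ ≤ (|deriv F x| + e) * ‖y - x‖ := by
      have h3 : F y - F x = (F y - F x - (y - x) • deriv F x) + (y - x) • deriv F x := by ring
      rw [h3]
      refine (norm_add_le _ _).trans ?_
      rw [norm_smul, Real.norm_eq_abs (deriv F x)]
      linarith
    calc _ ≤ _ := h1
      _ ≤ C * ((|deriv F x| + e) * ‖y - x‖) := by gcongr
      _ = _ := by ring
  refine le_of_forall_pos_le_add fun e he => ?_
  have := key (e / (C + 1)) (by positivity)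
  have h4 : C * (e / (C + 1)) ≤ e := by
    rw [mul_div_assoc', div_le_iff₀ (by positivity)]
    nlinarith
  linarith

/-- The product of the two difference quotients is nonnegative, and this survives in the limit. -/
theorem deriv_comp_mul_deriv_nonneg {Φ : ℝ → ℝ} (hΦ : Monotone Φ) {x : ℝ}
    (hF : DifferentiableAt ℝ F x) (hΦF : DifferentiableAt ℝ (fun x => Φ (F x)) x) :
    0 ≤ deriv (fun x => Φ (F x)) x * deriv F x := by
  have h1 := hasDerivAt_iff_tendsto_slope.1 hF.hasDerivAt
  have h2 := hasDerivAt_iff_tendsto_slope.1 hΦF.hasDerivAt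
  refine ge_of_tendsto (h2.mul h1) (Eventually.of_forall fun y => ?_)
  have h3 : 0 ≤ (Φ (F y) - Φ (F x)) * (F y - F x) := by
    rcases le_total (F x) (F y) with h | h
    · exact mul_nonneg (sub_nonneg.2 (hΦ h)) (sub_nonneg.2 h)
    · exact mul_nonneg_of_nonpos_of_nonpos (sub_nonpos.2 (hΦ h)) (sub_nonpos.2 h)
  simp only [slope_def_field]
  rw [div_mul_div_comm]
  exact div_nonneg h3 (mul_self_nonneg _)

end AbsolutelyContinuous

/-! ### Absolutely continuous functions and primitives on `[-L, L]` -/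

section Interval

variable {L : ℝ}

theorem intervalIntegrable_of_integrable (hL : 0 < L) {q : ℝ → ℝ} (hq : Integrable q (vol L)) :
    IntervalIntegrable q volume (-L) L :=
  (intervalIntegrable_iff_integrableOn_Ioo_of_le (by linarith)).2 hq

theorem integral_vol (hL : 0 < L) (q : ℝ → ℝ) :
    ∫ x, q x ∂(vol L) = ∫ x in (-L)..L, q x := by
  rw [intervalIntegral.integral_of_le (by linarith), integral_Ioc_eq_integral_Ioo]

theorem ae_vol_of_ae (p : ℝ → Prop) (h : ∀ᵐ x, x ∈ Ioo (-L) L → p x) : ∀ᵐ x ∂(vol L), p x :=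
  (ae_restrict_iff' measurableSet_Ioo).2 h

theorem ae_vol_mem : ∀ᵐ x ∂(vol L), x ∈ Ioo (-L) L := ae_restrict_mem measurableSet_Ioo

theorem uIcc_neg_self (hL : 0 < L) : uIcc (-L) L = Icc (-L) L := uIcc_of_le (by linarith)

/-- Functions that are absolutely continuous on `[-L, L]`. -/
abbrev AC (L : ℝ) (F : ℝ → ℝ) : Prop := AbsolutelyContinuousOnInterval F (-L) L

theorem AC.ae_differentiableAt (hL : 0 < L) {F : ℝ → ℝ} (hF : AC L F) :
    ∀ᵐ x ∂(vol L), DifferentiableAt ℝ F x := by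
  refine ae_vol_of_ae _ ?_
  filter_upwards [AbsolutelyContinuousOnInterval.ae_differentiableAt hF] with x hx hm
  exact hx (by rw [uIcc_neg_self hL]; exact Ioo_subset_Icc_self hm)

theorem AC.continuousOn_Icc (hL : 0 < L) {F : ℝ → ℝ} (hF : AC L F) :
    ContinuousOn F (Icc (-L) L) := by
  have := AbsolutelyContinuousOnInterval.continuousOn hF
  rwa [uIcc_neg_self hL] at this

theorem AC.exists_bound_Icc (hL : 0 < L) {F : ℝ → ℝ} (hF : AC L F) :
    ∃ C, ∀ x ∈ Icc (-L) L, |F x| ≤ C := by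
  obtain ⟨C, hC⟩ := AbsolutelyContinuousOnInterval.exists_bound hF
  rw [uIcc_neg_self hL] at hC
  exact ⟨C, hC⟩

theorem AC.aestronglyMeasurable (hL : 0 < L) {F : ℝ → ℝ} (hF : AC L F) :
    AEStronglyMeasurable F (vol L) :=
  ((hF.continuousOn_Icc hL).mono Ioo_subset_Icc_self).aestronglyMeasurable measurableSet_Ioo

theorem AC.memLp_top (hL : 0 < L) {F : ℝ → ℝ} (hF : AC L F) : MemLp F ⊤ (vol L) := by
  obtain ⟨C, hC⟩ := hF.exists_bound_Icc hL
  refine memLp_top_of_bound (hF.aestronglyMeasurable hL) C ?_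
  filter_upwards [ae_vol_mem] with x hx using hC x (Ioo_subset_Icc_self hx)

theorem AC.memLp_two (hL : 0 < L) {F : ℝ → ℝ} (hF : AC L F) : MemLp F 2 (vol L) :=
  (hF.memLp_top hL).mono_exponent le_top

/-- The primitive of `q` that vanishes at `-L`. -/
def prim (L : ℝ) (q : ℝ → ℝ) (x : ℝ) : ℝ := ∫ t in (-L)..x, q t

theorem prim_left (q : ℝ → ℝ) : prim L q (-L) = 0 := intervalIntegral.integral_same

theorem prim_right (hL : 0 < L) (q : ℝ → ℝ) : prim L q L = ∫ x, q x ∂(vol L) :=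
  (integral_vol hL q).symm

theorem ac_prim (hL : 0 < L) {q : ℝ → ℝ} (hq : Integrable q (vol L)) : AC L (prim L q) :=
  (intervalIntegrable_of_integrable hL
    hq).absolutelyContinuousOnInterval_intervalIntegral left_mem_uIcc

theorem deriv_prim (hL : 0 < L) {q : ℝ → ℝ} (hq : Integrable q (vol L)) :
    deriv (prim L q) =ᵐ[vol L] q := by
  refine ae_vol_of_ae _ ?_
  filter_upwards [(intervalIntegrable_of_integrable hL hq).ae_hasDerivAt_integral] with x hx hm
  exact (hx (by rw [uIcc_neg_self hL]; exact Ioo_subset_Icc_self hm) _ left_mem_uIcc).deriv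

/-- An absolutely continuous function is the primitive of its derivative. -/
theorem AC.eq_add_prim (hL : 0 < L) {F q : ℝ → ℝ} (hF : AC L F) (hq : deriv F =ᵐ[vol L] q)
    {x : ℝ} (hx : x ∈ Icc (-L) L) : F x = F (-L) + prim L q x := by
  have hsub : uIcc (-L) x ⊆ uIcc (-L) L := by
    rw [uIcc_neg_self hL, uIcc_of_le hx.1]; exact Icc_subset_Icc_right hx.2
  have h1 := (AbsolutelyContinuousOnInterval.mono hF hsub).integral_deriv_eq_sub
  have h2 : ∫ t in (-L)..x, deriv F t = prim L q x := by
    refine intervalIntegral.integral_congr_ae ?_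
    have h3 := (ae_restrict_iff' (μ := volume) measurableSet_Ioo).1 hq
    -- For `x = L` the integration range contains the end point `L`, about which `hq` says nothing.
    have h4 : ∀ᵐ t : ℝ, t ≠ L := by simp [ae_iff, measure_singleton]
    filter_upwards [h3, h4] with t ht htL hm
    rw [uIoc_of_le hx.1] at hm
    exact ht ⟨hm.1, lt_of_le_of_ne (hm.2.trans hx.2) htL⟩
  linarith

theorem AC.integral_by_parts (hL : 0 < L) {F H f h : ℝ → ℝ} (hF : AC L F) (hH : AC L H)
    (hf : deriv F =ᵐ[vol L] f) (hh : deriv H =ᵐ[vol L] h) :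
    ∫ x, F x * h x ∂(vol L) = F L * H L - F (-L) * H (-L) - ∫ x, f x * H x ∂(vol L) := by
  have h1 := AbsolutelyContinuousOnInterval.integral_mul_deriv_eq_deriv_mul hF hH
  rw [← integral_vol hL, ← integral_vol hL] at h1
  rw [← integral_congr_ae (hf.mono fun x hx => by simp only [hx]
      : (fun x => deriv F x * H x) =ᵐ[vol L] fun x => f x * H x),
    ← integral_congr_ae (hh.mono fun x hx => by simp only [hx]
      : (fun x => F x * deriv H x) =ᵐ[vol L] fun x => F x * h x), h1]

/-- This is how `∂ₓw = J(p)` inherits an `L²` derivative from the flux `p`. -/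
theorem AC.deriv_comp_memLp (hL : 0 < L) {F : ℝ → ℝ} (hF : AC L F)
    (hd : MemLp (deriv F) 2 (vol L)) {Φ : ℝ → ℝ} {C : NNReal} (hΦ : LipschitzWith C Φ) :
    MemLp (deriv fun x => Φ (F x)) 2 (vol L) := by
  refine (hd.const_mul (C : ℝ)).mono (measurable_deriv _).aestronglyMeasurable ?_
  filter_upwards [hF.ae_differentiableAt hL] with x hx
  rw [norm_mul, NNReal.norm_eq]
  exact abs_deriv_comp_le hΦ hx

end Interval

/-! ### Weak derivatives and absolutely continuous representatives -/

section WeakDerivative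

variable {L : ℝ}

theorem IsWeakDeriv.congr {z y z' y' : ℝ → ℝ} (h : IsWeakDeriv L z z') (hz : z =ᵐ[vol L] y)
    (hz' : z' =ᵐ[vol L] y') : IsWeakDeriv L y y' := by
  intro φ hφ hc hs
  have := h φ hφ hc hs
  rw [integral_congr_ae (hz.mono fun x hx => by simp only [hx]
      : (fun x => z x * deriv φ x) =ᵐ[vol L] fun x => y x * deriv φ x),
    integral_congr_ae (hz'.mono fun x hx => by simp only [hx]
      : (fun x => z' x * φ x) =ᵐ[vol L] fun x => y' x * φ x)] at this
  exact this

theorem ac_of_contDiff {φ : ℝ → ℝ} (hφ : ContDiff ℝ ∞ φ) : AC L φ :=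
  (hφ.of_le (by exact_mod_cast le_top)).contDiffOn.absolutelyContinuousOnInterval

theorem eq_zero_of_tsupport_subset {φ : ℝ → ℝ} (hs : tsupport φ ⊆ Ioo (-L) L) :
    φ L = 0 ∧ φ (-L) = 0 :=
  ⟨image_eq_zero_of_notMem_tsupport fun h => lt_irrefl _ (hs h).2,
    image_eq_zero_of_notMem_tsupport fun h => lt_irrefl _ (hs h).1⟩

theorem AC.isWeakDeriv (hL : 0 < L) {F q : ℝ → ℝ} (hF : AC L F) (hq : deriv F =ᵐ[vol L] q) :
    IsWeakDeriv L F q := by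
  intro φ hφ _ hs
  obtain ⟨h1, h2⟩ := eq_zero_of_tsupport_subset hs
  rw [hF.integral_by_parts hL (ac_of_contDiff hφ) hq (ae_eq_refl _), h1, h2]
  ring

theorem IsWeakDeriv.memH1 {z q : X L} (h : IsWeakDeriv L z q) : MemH1 z ∧ weakDeriv z = q := by
  have h1 : MemH1 z := ⟨q, h⟩
  exact ⟨h1, (isWeakDeriv_weakDeriv h1).unique h⟩

theorem AC.memH1 (hL : 0 < L) {F : ℝ → ℝ} (hF : AC L F) {z q : X L} (hz : z =ᵐ[vol L] F)
    (hq : deriv F =ᵐ[vol L] q) : MemH1 z ∧ weakDeriv z = q :=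
  ((hF.isWeakDeriv hL hq).congr hz.symm (ae_eq_refl _)).memH1

/-- A test function with mean zero has a primitive that is a test function. -/
theorem exists_test_primitive {ψ : ℝ → ℝ} (hL : 0 < L) (hψ : ContDiff ℝ ∞ ψ)
    (hc : HasCompactSupport ψ) (hs : tsupport ψ ⊆ Ioo (-L) L) (h0 : ∫ x, ψ x ∂(vol L) = 0) :
    ∃ φ : ℝ → ℝ, ContDiff ℝ ∞ φ ∧ HasCompactSupport φ ∧ tsupport φ ⊆ Ioo (-L) L ∧
      deriv φ = ψ := by
  have hcont : Continuous ψ := hψ.continuous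
  have hder : ∀ x, HasDerivAt (prim L ψ) (ψ x) x := fun x =>
    intervalIntegral.integral_hasDerivAt_right (hcont.intervalIntegrable _ _)
      hcont.stronglyMeasurable.stronglyMeasurableAtFilter hcont.continuousAt
  have hd : deriv (prim L ψ) = ψ := funext fun x => (hder x).deriv
  obtain ⟨a, ha, b, hb, hab⟩ : ∃ a ∈ Ioo (-L) L, ∃ b ∈ Ioo (-L) L, tsupport ψ ⊆ Icc a b := by
    -- Adjoining `0` keeps the set nonempty when `ψ = 0`, so that its extreme points exist.
    have hK : IsCompact (insert 0 (tsupport ψ)) := IsCompact.insert hc 0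
    have hsub : insert 0 (tsupport ψ) ⊆ Ioo (-L) L :=
      insert_subset ⟨by linarith, hL⟩ hs
    obtain ⟨a, ha⟩ := hK.exists_isLeast (insert_nonempty _ _)
    obtain ⟨b, hb⟩ := hK.exists_isGreatest (insert_nonempty _ _)
    exact ⟨a, hsub ha.1, b, hsub hb.1, fun x hx =>
      ⟨ha.2 (mem_insert_of_mem _ hx), hb.2 (mem_insert_of_mem _ hx)⟩⟩
  have hz : ∀ x, x ∉ Icc a b → ψ x = 0 := fun x hx =>
    image_eq_zero_of_notMem_tsupport fun h => hx (hab h)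
  have hsupp : tsupport (prim L ψ) ⊆ Icc a b := by
    refine closure_minimal (fun x hx => ?_) isClosed_Icc
    by_contra hxab
    refine hx ?_
    rcases lt_or_ge x a with hxa | hxa
    · refine intervalIntegral.integral_zero_ae (Eventually.of_forall fun t ht => hz t fun h => ?_)
      rcases mem_uIoc.1 ht with h' | h'
      · linarith [h.1, h'.2]
      · linarith [h.1, h'.2, ha.1]
    · have hxb : b < x := by
        by_contra h; exact hxab ⟨hxa, not_lt.1 h⟩
      -- To the right of `b` the primitive equals the total integral of `ψ`, which is zero.
      have h1 : prim L ψ L - prim L ψ x = ∫ t in x..L, ψ t :=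
        intervalIntegral.integral_interval_sub_left (hcont.intervalIntegrable _ _)
          (hcont.intervalIntegrable _ _)
      have h2 : ∫ t in x..L, ψ t = 0 := by
        refine intervalIntegral.integral_zero_ae
          (Eventually.of_forall fun t ht => hz t fun h => ?_)
        rcases mem_uIoc.1 ht with h' | h'
        · linarith [h.2, h'.1]
        · linarith [h.2, h'.1, hb.2]
      rw [prim_right hL, h0, h2] at h1
      linarith
  refine ⟨prim L ψ, ?_, isCompact_Icc.of_isClosed_subset (isClosed_tsupport _) hsupp,
    hsupp.trans (Icc_subset_Ioo ha.1 hb.2), hd⟩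
  rw [contDiff_infty_iff_deriv, hd]
  exact ⟨fun x => (hder x).differentiableAt, hψ⟩

theorem integrable_mul_test {z φ : ℝ → ℝ} (hz : Integrable z (vol L)) (hφ : Continuous φ)
    (hc : HasCompactSupport φ) : Integrable (fun x => z x * φ x) (vol L) := by
  obtain ⟨C, hC⟩ := hc.exists_bound_of_continuous hφ
  exact hz.mul_bdd (c := C) hφ.aestronglyMeasurable (Eventually.of_forall hC)

/-- The lemma of du Bois-Reymond. -/
theorem ae_eq_const_of_isWeakDeriv_zero (hL : 0 < L) {z : ℝ → ℝ} (hz : Integrable z (vol L))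
    (h : IsWeakDeriv L z fun _ => 0) : ∃ c, ∀ᵐ x ∂(vol L), z x = c := by
  let B : ContDiffBump (0 : ℝ) := ⟨L / 4, L / 2, by positivity, by linarith⟩
  set ρ : ℝ → ℝ := B.normed volume with hρ
  have hρ1 : ContDiff ℝ ∞ ρ := B.contDiff_normed
  have hρ2 : HasCompactSupport ρ := B.hasCompactSupport_normed
  have hρ3 : tsupport ρ ⊆ Ioo (-L) L := by
    rw [hρ, B.tsupport_normed_eq, Real.closedBall_eq_Icc]
    exact Icc_subset_Ioo (by simp only [B]; linarith) (by simp only [B]; linarith)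
  have hvol : ∀ φ : ℝ → ℝ, tsupport φ ⊆ Ioo (-L) L → ∫ x, φ x ∂(vol L) = ∫ x, φ x := by
    intro φ hs
    refine setIntegral_eq_integral_of_forall_compl_eq_zero fun x hx => ?_
    exact image_eq_zero_of_notMem_tsupport fun h => hx (hs h)
  have hρ4 : ∫ x, ρ x ∂(vol L) = 1 := by rw [hvol _ hρ3]; exact B.integral_normed
  set c := ∫ x, z x * ρ x ∂(vol L) with hc
  refine ⟨c, ?_⟩
  have hint : ∀ φ : ℝ → ℝ, Continuous φ → HasCompactSupport φ → Integrable φ (vol L) :=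
    fun φ h1 h2 => (h1.integrable_of_hasCompactSupport h2).restrict
  have key : ∀ᵐ x ∂(volume : Measure ℝ), x ∈ Ioo (-L) L → z x - c = 0 := by
    refine isOpen_Ioo.ae_eq_zero_of_integral_contDiff_smul_eq_zero
      (IntegrableOn.locallyIntegrableOn (hz.sub (integrable_const c))) ?_
    intro φ hφ hφc hφs
    set m := ∫ x, φ x ∂(vol L) with hm
    have hsub : tsupport (fun x => φ x - m * ρ x) ⊆ tsupport φ ∪ tsupport ρ := by
      refine closure_minimal (fun x hx => ?_) ((isClosed_tsupport _).union (isClosed_tsupport _))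
      by_contra hcon
      rw [mem_union, not_or] at hcon
      exact hx (by simp [image_eq_zero_of_notMem_tsupport hcon.1,
        image_eq_zero_of_notMem_tsupport hcon.2])
    -- Subtracting `m ρ` removes the mean, so `φ - m ρ` is the derivative of a test function and is
    -- annihilated by `z`; hence `∫ z φ = c ∫ φ`.
    obtain ⟨Ψ, hΨ1, hΨ2, hΨ3, hΨ4⟩ := exists_test_primitive (ψ := fun x => φ x - m * ρ x) hL
      (hφ.sub (contDiff_const.mul hρ1))
      ((IsCompact.union hφc hρ2).of_isClosed_subset (isClosed_tsupport _) hsub)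
      (hsub.trans (union_subset hφs hρ3)) (by
        rw [integral_sub (hint _ hφ.continuous hφc)
          ((hint _ hρ1.continuous hρ2).const_mul m), integral_const_mul, hρ4, ← hm]
        ring)
    have h1 := h Ψ hΨ1 hΨ2 hΨ3
    rw [hΨ4] at h1
    simp only [zero_mul, integral_zero, neg_zero] at h1
    have i1 := integrable_mul_test hz hφ.continuous hφc
    have i2 := integrable_mul_test hz hρ1.continuous hρ2
    have h2 : (fun x => z x * (φ x - m * ρ x)) = fun x => z x * φ x - m * (z x * ρ x) := by
      funext x; ring
    rw [h2, integral_sub i1 (i2.const_mul m), integral_const_mul, ← hc] at h1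
    have h3 : ∫ x, φ x • (z x - c) = ∫ x, φ x • (z x - c) ∂(vol L) := by
      refine (setIntegral_eq_integral_of_forall_compl_eq_zero fun x hx => ?_).symm
      rw [image_eq_zero_of_notMem_tsupport fun h => hx (hφs h), zero_smul]
    have h4 : (fun x => φ x • (z x - c)) = fun x => z x * φ x - c * φ x := by
      funext x; simp only [smul_eq_mul]; ring
    rw [h3, h4, integral_sub i1 ((hint _ hφ.continuous hφc).const_mul c), integral_const_mul,
      ← hm]
    linarith
  filter_upwards [ae_vol_of_ae _ key] with x hx
  linarith

/-- Every function in `H¹(Ω)` has an absolutely continuous representative. -/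
theorem MemH1.exists_ac (hL : 0 < L) {z : X L} (hz : MemH1 z) :
    ∃ F, AC L F ∧ z =ᵐ[vol L] F ∧ deriv F =ᵐ[vol L] weakDeriv z := by
  have hq := X_integrable (weakDeriv z)
  have hP := ac_prim hL hq
  have hPi : Integrable (prim L (weakDeriv z)) (vol L) :=
    (hP.memLp_two hL).integrable (by norm_num)
  obtain ⟨c, hc⟩ := ae_eq_const_of_isWeakDeriv_zero hL ((X_integrable z).sub hPi) (by
    intro φ hφ hφc hs
    have h1 := isWeakDeriv_weakDeriv hz φ hφ hφc hs
    have h2 := hP.isWeakDeriv hL (deriv_prim hL hq) φ hφ hφc hs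
    have hdc : Continuous (deriv φ) := hφ.continuous_deriv (by exact_mod_cast le_top)
    simp only [Pi.sub_apply, sub_mul, zero_mul, integral_zero, neg_zero]
    rw [integral_sub (integrable_mul_test (X_integrable z) hdc hφc.deriv)
      (integrable_mul_test hPi hdc hφc.deriv), h1, h2, sub_self])
  refine ⟨fun x => c + prim L (weakDeriv z) x, (absolutelyContinuousOnInterval_const c).add hP,
    ?_, ?_⟩
  · filter_upwards [hc] with x hx
    simp only [Pi.sub_apply] at hx
    linarith
  · filter_upwards [deriv_prim hL hq] with x hx
    rw [deriv_const_add, hx]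

theorem MemH1.exists_bound (hL : 0 < L) {z : X L} (hz : MemH1 z) :
    ∃ C, ∀ᵐ x ∂(vol L), |z x| ≤ C := by
  obtain ⟨F, hF, hzF, _⟩ := hz.exists_ac hL
  obtain ⟨C, hC⟩ := hF.exists_bound_Icc hL
  refine ⟨C, ?_⟩
  filter_upwards [hzF, ae_vol_mem] with x hx hm
  rw [hx]; exact hC x (Ioo_subset_Icc_self hm)

/-- Continuous functions of `H¹` functions are bounded. -/
theorem MemH1.memLp_top_comp (hL : 0 < L) {z : X L} (hz : MemH1 z) {b : ℝ → ℝ}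
    (hb : Continuous b) : MemLp (fun x => b (z x)) ⊤ (vol L) := by
  obtain ⟨C, hC⟩ := hz.exists_bound hL
  obtain ⟨D, hD⟩ := isCompact_Icc.exists_bound_of_continuousOn (s := Icc (-C) C) hb.continuousOn
  refine memLp_top_of_bound (hb.comp_aestronglyMeasurable (Lp.aestronglyMeasurable z)) D ?_
  filter_upwards [hC] with x hx using hD _ (abs_le.1 hx)

end WeakDerivative

/-! ### Monotone equations in Hilbert spaces -/

section Hilbert

variable {H : Type*} [NormedAddCommGroup H] [InnerProductSpace ℝ H] [CompleteSpace H]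

/-- Zarantonello: a Lipschitz continuous strongly monotone operator has a zero. -/
theorem exists_eq_zero_of_strongly_monotone {A : H → H} {K : NNReal} {m : ℝ} (hm : 0 < m)
    (hA : LipschitzWith K A)
    (hmono : ∀ x y, m * ‖x - y‖ ^ 2 ≤ inner ℝ (A x - A y) (x - y)) : ∃ x, A x = 0 := by
  -- The map `x ↦ x - t A x` has squared Lipschitz constant at most `1 - 2tm + t²M²`, minimal at `t
  -- = m/M²` with value `1 - tm`. Enlarging `K` to `M = K + m` ensures `M > 0` and `tm ≤ 1`.
  set M : ℝ := K + m with hMdef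
  have hM : 0 < M := by positivity
  have hmM : m ≤ M := by rw [hMdef]; linarith [K.2]
  set t : ℝ := m / M ^ 2 with ht
  have ht0 : 0 < t := by positivity
  have htM : t * M ^ 2 = m := by rw [ht]; field_simp
  have hk0 : 0 ≤ 1 - t * m := by
    rw [ht, sub_nonneg, div_mul_eq_mul_div, div_le_one (by positivity)]
    nlinarith
  set k : NNReal := ⟨√(1 - t * m), Real.sqrt_nonneg _⟩ with hk
  have hk1 : k < 1 := by
    rw [← NNReal.coe_lt_coe]
    change √(1 - t * m) < 1
    rw [Real.sqrt_lt' one_pos]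
    have : 0 < t * m := by positivity
    linarith
  have hS : ContractingWith k fun x => x - t • A x := by
    refine ⟨hk1, LipschitzWith.of_dist_le_mul fun x y => ?_⟩
    rw [dist_eq_norm, dist_eq_norm]
    have h1 : x - t • A x - (y - t • A y) = (x - y) - t • (A x - A y) := by
      rw [smul_sub]; abel
    have h2 : ‖A x - A y‖ ≤ M * ‖x - y‖ := by
      have := hA.dist_le_mul x y
      rw [dist_eq_norm, dist_eq_norm] at this
      refine this.trans (mul_le_mul_of_nonneg_right ?_ (norm_nonneg _))
      rw [hMdef]; linarith
    have h3 : ‖(x - y) - t • (A x - A y)‖ ^ 2 ≤ (1 - t * m) * ‖x - y‖ ^ 2 := by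
      rw [norm_sub_sq_real, inner_smul_right, real_inner_comm, norm_smul, mul_pow,
        Real.norm_of_nonneg ht0.le]
      have h4 : ‖A x - A y‖ ^ 2 ≤ M ^ 2 * ‖x - y‖ ^ 2 := by
        rw [← mul_pow]; exact pow_le_pow_left₀ (norm_nonneg _) h2 2
      have h5 : t ^ 2 * ‖A x - A y‖ ^ 2 ≤ t * m * ‖x - y‖ ^ 2 := by
        calc t ^ 2 * ‖A x - A y‖ ^ 2 ≤ t ^ 2 * (M ^ 2 * ‖x - y‖ ^ 2) := by gcongr
          _ = t * (t * M ^ 2) * ‖x - y‖ ^ 2 := by ring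
          _ = _ := by rw [htM]
      have h6 := mul_le_mul_of_nonneg_left (hmono x y) ht0.le
      linarith
    rw [h1]
    change _ ≤ √(1 - t * m) * _
    rw [← Real.sqrt_sq (norm_nonneg (x - y)), ← Real.sqrt_mul hk0]
    exact Real.le_sqrt_of_sq_le h3
  have : Nonempty H := ⟨0⟩
  refine ⟨ContractingWith.fixedPoint _ hS, ?_⟩
  have h := hS.fixedPoint_isFixedPt
  rw [Function.IsFixedPt, sub_eq_self, smul_eq_zero] at h
  exact h.resolve_left ht0.ne'

variable {E F : Type*} [NormedAddCommGroup E] [InnerProductSpace ℝ E]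
  [NormedAddCommGroup F] [InnerProductSpace ℝ F] [CompleteSpace F]

/-- Solvability of the regularized variational equation on a closed subspace. -/
theorem exists_regularized_solution (M : Submodule ℝ E) [CompleteSpace M] {R : E → E} {J : F → F}
    {CR CJ : NNReal} (hRl : LipschitzWith CR R) (hJl : LipschitzWith CJ J)
    (hR : ∀ x y, 0 ≤ (inner ℝ (R x - R y) (x - y) : ℝ))
    (hJ : ∀ x y, 0 ≤ (inner ℝ (J x - J y) (x - y) : ℝ)) (T : E →L[ℝ] F) (h : E)
    {η : ℝ} (hη : 0 < η) :
    ∃ s, s - h ∈ M ∧ ∀ ψ ∈ M,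
      (inner ℝ (R s + η • s) ψ : ℝ) + inner ℝ (J (T (s - h))) (T ψ) = 0 := by
  let T' : M →L[ℝ] F := T.comp M.subtypeL
  -- Projection and adjoint represent the variational form by an operator on `M` itself, in the
  -- unknown `q = s - h`.
  let A : M → M := fun q =>
    M.orthogonalProjectionOnto (R ((q : E) + h) + η • ((q : E) + h)) + T'.adjoint (J (T' q))
  have hin : ∀ q ψ : M, (inner ℝ (A q) ψ : ℝ)
      = inner ℝ (R ((q : E) + h) + η • ((q : E) + h)) (ψ : E) + inner ℝ (J (T q)) (T ψ) := by
    intro q ψ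
    simp only [A, inner_add_left, ContinuousLinearMap.adjoint_inner_left]
    rw [Submodule.coe_inner, Submodule.coe_orthogonalProjectionOnto_apply,
      Submodule.inner_starProjection_left_eq_right,
      Submodule.starProjection_eq_self_iff.2 ψ.2, inner_add_left]
    rfl
  have hsh : LipschitzWith (‖M.subtypeL‖₊ + 0) fun q : M => (q : E) + h :=
    M.subtypeL.lipschitz.add (LipschitzWith.const h)
  obtain ⟨q, hq⟩ := exists_eq_zero_of_strongly_monotone (A := A) hη
    ((M.orthogonalProjectionOnto.lipschitz.comp ((hRl.comp hsh).add ((lipschitzWith_smul η).comp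
      hsh))).add (T'.adjoint.lipschitz.comp (hJl.comp T'.lipschitz))) (by
    intro x y
    have h1 := hR ((x : E) + h) ((y : E) + h)
    have h2 := hJ (T x) (T y)
    have h3 : (inner ℝ (A x - A y) (x - y) : ℝ)
        = inner ℝ (R ((x : E) + h) - R ((y : E) + h)) ((x : E) + h - ((y : E) + h))
          + inner ℝ (J (T x) - J (T y)) (T x - T y) + η * ‖x - y‖ ^ 2 := by
      rw [inner_sub_left, hin, hin, ← real_inner_self_eq_norm_sq, Submodule.coe_inner]
      simp only [Submodule.coe_sub, map_sub, inner_sub_left, inner_sub_right, inner_add_left,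
        inner_add_right, inner_smul_left, RCLike.conj_to_real]
      ring
    rw [h3]; linarith)
  refine ⟨q + h, by simp, fun ψ hψ => ?_⟩
  have := hin q ⟨ψ, hψ⟩
  rw [hq, inner_zero_left] at this
  rw [add_sub_cancel_right]
  exact this.symm

/-- A uniformly bounded family with the accretivity relation of Crandall and Pazy is Cauchy. -/
theorem cauchySeq_of_crandall_pazy {s : ℕ → E} {η : ℕ → ℝ} (hη : ∀ k, 0 < η k)
    (hanti : Antitone η) {C : ℝ} (hC : ∀ k, ‖s k‖ ≤ C)
    (h : ∀ k l, (inner ℝ (η k • s k - η l • s l) (s k - s l) : ℝ) ≤ 0) : CauchySeq s := by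
  -- By polarization `h` reads `(η k + η l) ‖s k - s l‖² ≤ (η k - η l) (‖s l‖² - ‖s k‖²)`, with `0 ≤
  -- η k - η l ≤ η k + η l`. The norms therefore increase, and they are bounded, so their
  -- convergence controls the differences.
  have key : ∀ k l, k ≤ l → ‖s k - s l‖ ^ 2 ≤ ‖s l‖ ^ 2 - ‖s k‖ ^ 2 := by
    intro k l hkl
    have h1 := h k l
    have h2 : 2 * (inner ℝ (η k • s k - η l • s l) (s k - s l) : ℝ)
        = (η k + η l) * ‖s k - s l‖ ^ 2 + (η k - η l) * (‖s k‖ ^ 2 - ‖s l‖ ^ 2) := by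
      rw [norm_sub_sq_real]
      simp only [inner_sub_left, inner_sub_right, inner_smul_left, RCLike.conj_to_real,
        real_inner_self_eq_norm_sq, real_inner_comm (s k) (s l)]
      ring
    have h3 := hanti hkl
    have h4 := hη k
    have h5 := hη l
    by_contra! hcon
    rcases le_total (‖s k‖ ^ 2) (‖s l‖ ^ 2) with h6 | h6
    · have : (η k - η l) * (‖s l‖ ^ 2 - ‖s k‖ ^ 2) ≤ (η k + η l) * (‖s l‖ ^ 2 - ‖s k‖ ^ 2) :=
        mul_le_mul_of_nonneg_right (by linarith) (by linarith)
      nlinarith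
    · have h7 : 0 ≤ (η k - η l) * (‖s k‖ ^ 2 - ‖s l‖ ^ 2) :=
        mul_nonneg (by linarith) (by linarith)
      have h8 : (η k + η l) * ‖s k - s l‖ ^ 2 ≤ 0 := by linarith
      have h9 : ‖s k - s l‖ ^ 2 ≤ 0 := by
        by_contra! h10
        have : 0 < (η k + η l) * ‖s k - s l‖ ^ 2 := by positivity
        linarith
      have h11 : ‖s k - s l‖ = 0 :=
        pow_eq_zero_iff two_ne_zero |>.1 (le_antisymm h9 (sq_nonneg _))
      rw [sub_eq_zero.1 (norm_eq_zero.1 h11)] at hcon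
      simp at hcon
  have hmono : Monotone fun k => ‖s k‖ ^ 2 := fun k l hkl => by
    have := key k l hkl
    simp only
    linarith [sq_nonneg ‖s k - s l‖]
  have hbdd : BddAbove (range fun k => ‖s k‖ ^ 2) :=
    ⟨C ^ 2, by rintro _ ⟨k, rfl⟩; exact pow_le_pow_left₀ (norm_nonneg _) (hC k) 2⟩
  have hcau := (tendsto_atTop_ciSup hmono hbdd).cauchySeq
  rw [Metric.cauchySeq_iff'] at hcau ⊢
  intro e he
  obtain ⟨N, hN⟩ := hcau (e ^ 2) (by positivity)
  refine ⟨N, fun n hn => ?_⟩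
  have h1 := key N n hn
  have h2 := hN n hn
  rw [Real.dist_eq] at h2
  rw [dist_comm, dist_eq_norm]
  exact lt_of_pow_lt_pow_left₀ 2 he.le (by linarith [le_abs_self (‖s n‖ ^ 2 - ‖s N‖ ^ 2)])

/-- Solvability of a degenerate monotone variational equation on a closed subspace, given an a
priori estimate for its regularizations. -/
theorem exists_solution_of_apriori_bound [CompleteSpace E] (M : Submodule ℝ E) [CompleteSpace M] {R : E → E}
    {J : F → F} {CR CJ : NNReal} (hRl : LipschitzWith CR R) (hJl : LipschitzWith CJ J)
    (hR : ∀ x y, 0 ≤ (inner ℝ (R x - R y) (x - y) : ℝ))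
    (hJ : ∀ x y, 0 ≤ (inner ℝ (J x - J y) (x - y) : ℝ)) (T : E →L[ℝ] F) (h : E) (C : ℝ)
    (hbound : ∀ η : ℝ, 0 < η → ∀ s, s - h ∈ M →
      (∀ ψ ∈ M, (inner ℝ (R s + η • s) ψ : ℝ) + inner ℝ (J (T (s - h))) (T ψ) = 0) → ‖s‖ ≤ C) :
    ∃ s, s - h ∈ M ∧ ∀ ψ ∈ M, (inner ℝ (R s) ψ : ℝ) + inner ℝ (J (T (s - h))) (T ψ) = 0 := by
  set η : ℕ → ℝ := fun k => 1 / ((k : ℝ) + 1) with hη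
  have hη0 : ∀ k, 0 < η k := fun k => Nat.one_div_pos_of_nat
  choose s hs1 hs2 using fun k => exists_regularized_solution M hRl hJl hR hJ T h (hη0 k)
  -- Two regularized equations are subtracted and tested with `s k - s l ∈ M`; the monotone terms
  -- have a sign and drop out.
  have hcau : CauchySeq s := by
    refine cauchySeq_of_crandall_pazy hη0
      (fun k l hkl => Nat.one_div_le_one_div hkl)
      (fun k => hbound (η k) (hη0 k) (s k) (hs1 k) (hs2 k)) fun k l => ?_
    have hm : s k - s l ∈ M := by
      have := M.sub_mem (hs1 k) (hs1 l)
      rwa [sub_sub_sub_cancel_right] at this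
    have h1 := hs2 k _ hm
    have h2 := hs2 l _ hm
    have h3 := hR (s k) (s l)
    have h4 := hJ (T (s k - h)) (T (s l - h))
    rw [← map_sub, sub_sub_sub_cancel_right] at h4
    simp only [inner_add_left, inner_sub_left] at h1 h2 h3 h4 ⊢
    linarith
  obtain ⟨s₀, hs₀⟩ := cauchySeq_tendsto_of_complete hcau
  have hη_lim : Tendsto η atTop (𝓝 0) := tendsto_one_div_add_atTop_nhds_zero_nat
  refine ⟨s₀, ?_, fun ψ hψ => ?_⟩
  · have hcl : IsClosed (M : Set E) := (completeSpace_coe_iff_isComplete.1 ‹_›).isClosed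
    exact hcl.mem_of_tendsto (hs₀.sub_const h) (Eventually.of_forall hs1)
  -- Strong convergence of `s` lets the nonlinear terms pass to the limit by continuity alone.
  · have h1 : Tendsto (fun k => (inner ℝ (R (s k) + η k • s k) ψ : ℝ)
        + inner ℝ (J (T (s k - h))) (T ψ)) atTop
        (𝓝 (inner ℝ (R s₀ + (0 : ℝ) • s₀) ψ + inner ℝ (J (T (s₀ - h))) (T ψ))) := by
      have hR' := (hRl.continuous.tendsto s₀).comp hs₀
      have hJ' := ((hJl.continuous.comp T.continuous).tendsto (s₀ - h)).comp (hs₀.sub_const h)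
      exact ((hR'.add (hη_lim.smul hs₀)).inner tendsto_const_nhds).add
        (hJ'.inner tendsto_const_nhds)
    simp only [hs2 _ ψ hψ, zero_smul, add_zero] at h1
    exact (tendsto_nhds_unique h1 tendsto_const_nhds)

end Hilbert

/-! ### The primitive as a bounded operator, and functions of mean zero -/

section Primitive

variable {L : ℝ}

theorem inner_eq_integral (a b : X L) : (inner ℝ a b : ℝ) = ∫ x, a x * b x ∂(vol L) := by
  rw [L2.inner_def]
  exact integral_congr_ae (Eventually.of_forall fun x => by simp [mul_comm])

theorem integrable_mul (a b : X L) : Integrable (fun x => a x * b x) (vol L) :=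
  MemLp.integrable_mul (Lp.memLp a) (Lp.memLp b)

/-- The constant function `1`. -/
def one (L : ℝ) : X L := (memLp_const (1 : ℝ)).toLp _

theorem coeFn_one : ∀ᵐ x ∂(vol L), one L x = 1 := MemLp.coeFn_toLp _

theorem inner_one (q : X L) : (inner ℝ (one L) q : ℝ) = ∫ x, q x ∂(vol L) := by
  rw [inner_eq_integral]
  refine integral_congr_ae ?_
  filter_upwards [coeFn_one] with x hx
  rw [hx, one_mul]

theorem integral_abs_le (q : X L) : ∫ x, |q x| ∂(vol L) ≤ ‖one L‖ * ‖q‖ := by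
  have h1 : ∫ x, |q x| ∂(vol L) = inner ℝ (one L) |q| := by
    rw [inner_one]
    exact integral_congr_ae ((Lp.coeFn_abs q).mono fun x hx => hx.symm)
  rw [h1, ← norm_abs_eq_norm q]
  exact real_inner_le_norm _ _

theorem abs_prim_le (q : X L) {x : ℝ} (hx : x ∈ Icc (-L) L) :
    |prim L q x| ≤ ‖one L‖ * ‖q‖ := by
  refine le_trans ?_ (integral_abs_le q)
  rw [prim, intervalIntegral.integral_of_le hx.1, integral_Ioc_eq_integral_Ioo]
  refine (abs_integral_le_integral_abs).trans ?_
  exact setIntegral_mono_set (X_integrable q).abs (Eventually.of_forall fun t => abs_nonneg _)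
    (Ioo_subset_Ioo_right hx.2).eventuallyLE

theorem prim_congr (hL : 0 < L) {q r : ℝ → ℝ} (hq : Integrable q (vol L)) (h : q =ᵐ[vol L] r)
    {x : ℝ} (hx : x ∈ Icc (-L) L) : prim L q x = prim L r x := by
  have := (ac_prim hL hq).eq_add_prim hL ((deriv_prim hL hq).trans h) hx
  rwa [prim_left, zero_add] at this

/-- The primitive vanishing at `-L` as a bounded operator of `L²(Ω)`. -/
def primL (L : ℝ) (hL : 0 < L) : X L →L[ℝ] X L :=
  LinearMap.mkContinuous
    { toFun := fun q => ((ac_prim hL (X_integrable q)).memLp_two hL).toLp (prim L q)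
      map_add' := fun p q => by
        rw [← MemLp.toLp_add]
        refine (MemLp.toLp_eq_toLp_iff _ _).2 ?_
        filter_upwards [ae_vol_mem] with x hx
        have hx' := Ioo_subset_Icc_self hx
        rw [prim_congr hL (X_integrable _) (Lp.coeFn_add p q) hx']
        have hsub : uIcc (-L) x ⊆ uIcc (-L) L := by
          rw [uIcc_neg_self hL, uIcc_of_le hx'.1]; exact Icc_subset_Icc_right hx'.2
        exact intervalIntegral.integral_add
          ((intervalIntegrable_of_integrable hL (X_integrable p)).mono_set hsub)
          ((intervalIntegrable_of_integrable hL (X_integrable q)).mono_set hsub)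
      map_smul' := fun c q => by
        rw [RingHom.id_apply, ← MemLp.toLp_const_smul]
        refine (MemLp.toLp_eq_toLp_iff _ _).2 ?_
        filter_upwards [ae_vol_mem] with x hx
        rw [prim_congr hL (X_integrable _) (Lp.coeFn_smul c q) (Ioo_subset_Icc_self hx)]
        exact intervalIntegral.integral_smul c (fun t => q t) }
    (measureUnivNNReal (vol L) ^ (2 : ENNReal).toReal⁻¹ * ‖one L‖) fun q => by
      rw [mul_assoc]
      refine Lp.norm_le_of_ae_bound (by positivity) ?_
      filter_upwards [((ac_prim hL (X_integrable q)).memLp_two hL).coeFn_toLp, ae_vol_mem]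
        with x hx hm
      simp only [LinearMap.coe_mk, AddHom.coe_mk]
      rw [hx]
      exact abs_prim_le q (Ioo_subset_Icc_self hm)

theorem coeFn_primL (hL : 0 < L) (q : X L) : primL L hL q =ᵐ[vol L] prim L q :=
  ((ac_prim hL (X_integrable q)).memLp_two hL).coeFn_toLp

theorem memH1_primL (hL : 0 < L) (q : X L) :
    MemH1 (primL L hL q) ∧ weakDeriv (primL L hL q) = q :=
  (ac_prim hL (X_integrable q)).memH1 hL (coeFn_primL hL q) (deriv_prim hL (X_integrable q))

theorem memH1_one (hL : 0 < L) : MemH1 (one L) ∧ weakDeriv (one L) = 0 := by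
  refine AC.memH1 hL (F := fun _ => 1) (absolutelyContinuousOnInterval_const 1) coeFn_one ?_
  filter_upwards [Lp.coeFn_zero ℝ 2 (vol L)] with x hx
  rw [hx]; simp

/-- The functions with mean zero. -/
def meanZero (L : ℝ) : Submodule ℝ (X L) := (Submodule.span ℝ {one L})ᗮ

instance : CompleteSpace (meanZero L) :=
  inferInstanceAs (CompleteSpace ((Submodule.span ℝ {one L})ᗮ : Submodule ℝ (X L)))

theorem mem_meanZero_iff {q : X L} : q ∈ meanZero L ↔ ∫ x, q x ∂(vol L) = 0 := by
  rw [meanZero, Submodule.mem_orthogonal_singleton_iff_inner_right, inner_one]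

/-- For a test function `φ`, the function `φ'` has mean zero and primitive `φ`, so `ψ = φ'` is
admissible. -/
theorem isWeakDeriv_of_forall_meanZero (hL : 0 < L) {a b : X L}
    (h : ∀ ψ ∈ meanZero L, (inner ℝ a ψ : ℝ) + inner ℝ b (primL L hL ψ) = 0) :
    IsWeakDeriv L a b := by
  intro φ hφ hc hs
  obtain ⟨h1, h2⟩ := eq_zero_of_tsupport_subset hs
  have hdc : Continuous (deriv φ) := hφ.continuous_deriv (by exact_mod_cast le_top)
  have hm : MemLp (deriv φ) 2 (vol L) :=
    (hdc.memLp_of_hasCompactSupport hc.deriv : MemLp (deriv φ) 2 volume).restrict _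
  have hψ := hm.coeFn_toLp
  have hrep : ∀ x ∈ Icc (-L) L, φ x = prim L (hm.toLp (deriv φ)) x := fun x hx => by
    rw [(ac_of_contDiff hφ).eq_add_prim hL hψ.symm hx, h2, zero_add]
  have hmean : hm.toLp (deriv φ) ∈ meanZero L := by
    rw [mem_meanZero_iff, ← prim_right hL, ← hrep L ⟨by linarith, le_refl L⟩, h1]
  have h3 := h _ hmean
  rw [inner_eq_integral, inner_eq_integral] at h3
  have e1 : ∫ x, a x * hm.toLp (deriv φ) x ∂(vol L) = ∫ x, a x * deriv φ x ∂(vol L) :=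
    integral_congr_ae (hψ.mono fun x hx => by simp only [hx])
  have e2 : ∫ x, b x * primL L hL (hm.toLp (deriv φ)) x ∂(vol L)
      = ∫ x, b x * φ x ∂(vol L) := by
    refine integral_congr_ae ?_
    filter_upwards [coeFn_primL hL (hm.toLp (deriv φ)), ae_vol_mem] with x hx hxm
    rw [hx, hrep x (Ioo_subset_Icc_self hxm)]
  linarith

end Primitive

/-! ### The stationary problem in dual form -/

section Stationary

variable {L : ℝ}

theorem inner_compLp_nonneg {Φ : ℝ → ℝ} {C : NNReal} (hΦ : LipschitzWith C Φ) (h0 : Φ 0 = 0)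
    (hmono : Monotone Φ) (a b : X L) :
    0 ≤ (inner ℝ (hΦ.compLp h0 a - hΦ.compLp h0 b) (a - b) : ℝ) := by
  rw [inner_eq_integral]
  refine integral_nonneg_of_ae ?_
  filter_upwards [Lp.coeFn_sub (hΦ.compLp h0 a) (hΦ.compLp h0 b), Lp.coeFn_sub a b,
    hΦ.coeFn_compLp h0 a, hΦ.coeFn_compLp h0 b] with x h1 h2 h3 h4
  rw [h1, h2, Pi.sub_apply, Pi.sub_apply, h3, h4]
  rcases le_total (a x) (b x) with h | h
  · exact mul_nonneg_of_nonpos_of_nonpos (sub_nonpos.2 (hmono h)) (sub_nonpos.2 h)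
  · exact mul_nonneg (sub_nonneg.2 (hmono h)) (sub_nonneg.2 h)

/-- The a priori estimate in `L²(Ω)`. -/
theorem norm_le_of_isWeakDeriv (hL : 0 < L) {R J : ℝ → ℝ} (hR : Monotone R) (hJ : Monotone J)
    (hRc : Continuous R) (hJ0 : J 0 = 0) {η : ℝ} (hη : 0 < η) {s h z b : X L}
    (hs : ∫ x, (s - h : X L) x ∂(vol L) = 0) (hz : ∀ᵐ x ∂(vol L), z x = R (s x) + η * s x)
    (hb : ∀ᵐ x ∂(vol L), b x = J (prim L (s - h : X L) x)) (hzb : IsWeakDeriv L z b) :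
    ‖s‖ ≤ ‖h‖ := by
  have hstrong : ∀ x y, η * (x - y) ^ 2 ≤ ((R x + η * x) - (R y + η * y)) * (x - y) := by
    intro x y
    have : 0 ≤ (R x - R y) * (x - y) := by
      rcases le_total x y with h | h
      · exact mul_nonneg_of_nonpos_of_nonpos (sub_nonpos.2 (hR h)) (sub_nonpos.2 h)
      · exact mul_nonneg (sub_nonneg.2 (hR h)) (sub_nonneg.2 h)
    nlinarith
  -- The inverse `B` of `t ↦ R t + η t` is Lipschitz and recovers `s = B(z)`, so `s` inherits an
  -- absolutely continuous representative. Its Lipschitz constant depends on `η`, but the final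
  -- bound does not.
  have hsurj := surjective_of_strongly_monotone (b := fun t => R t + η * t)
    (by fun_prop) hη hstrong
  choose B hB using hsurj
  simp only at hB
  obtain ⟨hBm, hBl⟩ := monotone_lipschitz_of_strongly_monotone (R := B) hη fun x y => by
    have := hstrong (B x) (B y)
    rwa [hB, hB] at this
  have hBinv : ∀ t, B (R t + η * t) = t := fun t => by
    have h1 := hstrong (B (R t + η * t)) t
    rw [hB, sub_self, zero_mul] at h1
    have h2 : (B (R t + η * t) - t) ^ 2 ≤ 0 := by
      by_contra! h3
      have : 0 < η * (B (R t + η * t) - t) ^ 2 := by positivity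
      linarith
    exact sub_eq_zero.1 (pow_eq_zero_iff two_ne_zero |>.1 (le_antisymm h2 (sq_nonneg _)))
  obtain ⟨hzH, hzd⟩ := hzb.memH1
  obtain ⟨W, hW, hzW, hWd⟩ := hzH.exists_ac hL
  rw [hzd] at hWd
  set q : X L := s - h with hq
  have hS : AC L fun x => B (W x) := absolutelyContinuousOnInterval_comp hBl hW
  have hparts := hS.integral_by_parts hL (ac_prim hL (X_integrable q)) (ae_eq_refl _)
    (deriv_prim hL (X_integrable q))
  rw [prim_left, prim_right hL, hs] at hparts
  -- With `P = prim L q`, the derivative of `B(W)` has the sign of `W' = J(P)`, hence that of `P`,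
  -- because `J` is nondecreasing and `J 0 = 0`. Where `J(P) = 0`, the Lipschitz bound makes the
  -- derivative zero.
  have hnonneg : 0 ≤ ∫ x, deriv (fun x => B (W x)) x * prim L q x ∂(vol L) := by
    refine integral_nonneg_of_ae ?_
    filter_upwards [hW.ae_differentiableAt hL, hS.ae_differentiableAt hL, hWd, hb]
      with x h1 h2 h3 h4
    have h5 := deriv_comp_mul_deriv_nonneg hBm h1 h2
    have h6 := abs_deriv_comp_le hBl h1
    rw [h3, h4] at h5 h6
    simp only [Pi.zero_apply]
    by_cases h7 : J (prim L q x) = 0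
    · rw [h7, abs_zero, mul_zero] at h6
      rw [abs_eq_zero.1 (le_antisymm h6 (abs_nonneg _)), zero_mul]
    · rcases le_total 0 (prim L q x) with h8 | h8
      · have h9 : 0 < J (prim L q x) :=
          lt_of_le_of_ne (by simpa [hJ0] using hJ h8) (Ne.symm h7)
        exact mul_nonneg (nonneg_of_mul_nonneg_left h5 h9) h8
      · have h9 : J (prim L q x) < 0 := lt_of_le_of_ne (by simpa [hJ0] using hJ h8) h7
        refine mul_nonneg_of_nonpos_of_nonpos ?_ h8
        by_contra! h10
        linarith [mul_neg_of_pos_of_neg h10 h9]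
  have hsq : (inner ℝ s q : ℝ) ≤ 0 := by
    rw [inner_eq_integral]
    have : ∫ x, s x * q x ∂(vol L) = ∫ x, B (W x) * q x ∂(vol L) := by
      refine integral_congr_ae ?_
      filter_upwards [hz, hzW] with x h1 h2
      rw [← h2, h1, hBinv]
    rw [this, hparts]
    linarith
  rw [hq, inner_sub_right, real_inner_self_eq_norm_sq] at hsq
  have h1 := real_inner_le_norm s h
  by_contra! hcon
  have h2 : 0 < ‖s‖ := (norm_nonneg h).trans_lt hcon
  nlinarith

/-- Existence for the stationary problem in dual form. -/
theorem exists_stationary (hL : 0 < L) {R J : ℝ → ℝ} {CR CJ : NNReal} (hR : Monotone R)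
    (hRl : LipschitzWith CR R) (hJ : Monotone J) (hJl : LipschitzWith CJ J) (hJ0 : J 0 = 0)
    (h : X L) :
    ∃ s w : X L, ∫ x, (s - h : X L) x ∂(vol L) = 0 ∧ (∀ᵐ x ∂(vol L), w x = R (s x)) ∧
      MemH1 w ∧ ∀ᵐ x ∂(vol L), weakDeriv w x = J (prim L (s - h : X L) x) := by
  -- `compLp` needs a function vanishing at `0`. The constant `R 0` is added back to `w` below
  -- without changing the weak derivative.
  set R₀ : ℝ → ℝ := fun t => R t - R 0 with hR₀
  have hR₀l : LipschitzWith CR R₀ := LipschitzWith.of_dist_le_mul fun x y => by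
    simpa [hR₀, dist_eq_norm] using hRl.dist_le_mul x y
  have hR₀m : Monotone R₀ := fun x y hxy => sub_le_sub_right (hR hxy) _
  have hR₀0 : R₀ 0 = 0 := sub_self _
  have hJae : ∀ q : X L, ∀ᵐ x ∂(vol L), hJl.compLp hJ0 (primL L hL q) x = J (prim L q x) := by
    intro q
    filter_upwards [hJl.coeFn_compLp hJ0 (primL L hL q), coeFn_primL hL q] with x h1 h2
    rw [h1, Function.comp_apply, h2]
  obtain ⟨s, hs, heq⟩ := exists_solution_of_apriori_bound (meanZero L)
    (LipschitzWith.lipschitzWith_compLp hR₀l hR₀0) (LipschitzWith.lipschitzWith_compLp hJl hJ0)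
    (inner_compLp_nonneg hR₀l hR₀0 hR₀m) (inner_compLp_nonneg hJl hJ0 hJ) (primL L hL) h ‖h‖ (by
      intro η hη s hs heq
      refine norm_le_of_isWeakDeriv hL hR₀m hJ hR₀l.continuous hJ0 hη (mem_meanZero_iff.1 hs) ?_
        (hJae _) (isWeakDeriv_of_forall_meanZero hL heq)
      filter_upwards [Lp.coeFn_add (hR₀l.compLp hR₀0 s) (η • s), Lp.coeFn_smul η s,
        hR₀l.coeFn_compLp hR₀0 s] with x h1 h2 h3
      rw [h1, Pi.add_apply, h2, h3]
      rfl)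
  obtain ⟨h1, h2⟩ := (isWeakDeriv_of_forall_meanZero hL heq).memH1
  obtain ⟨F, hF, hF1, hF2⟩ := h1.exists_ac hL
  rw [h2] at hF2
  have hF' : AC L fun x => F x + R 0 := hF.add (absolutelyContinuousOnInterval_const _)
  have hw := (hF'.memLp_two hL).coeFn_toLp
  obtain ⟨h3, h4⟩ := hF'.memH1 hL hw (q := hJl.compLp hJ0 (primL L hL (s - h))) (by
    filter_upwards [hF2] with x hx
    rw [deriv_add_const, hx])
  refine ⟨s, _, mem_meanZero_iff.1 hs, ?_, h3, ?_⟩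
  · filter_upwards [hw, hF1, hR₀l.coeFn_compLp hR₀0 s] with x e1 e2 e3
    rw [e1, ← e2, e3, Function.comp_apply, hR₀]
    ring
  · rw [h4]
    exact hJae _

end Stationary

/-! ### Total variation on `H¹(Ω)` -/

section TotalVariation

variable {L : ℝ}

theorem eqOn_Icc_of_ae_eq (hL : 0 < L) {F H : ℝ → ℝ} (hF : ContinuousOn F (Icc (-L) L))
    (hH : ContinuousOn H (Icc (-L) L)) (h : F =ᵐ[vol L] H) : EqOn F H (Icc (-L) L) := by
  refine Measure.eqOn_Icc_of_ae_eq (μ := volume) (by linarith : (-L) ≠ L) ?_ hF hH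
  rwa [← restrict_Ioo_eq_restrict_Icc]

/-- Integration by parts has no boundary terms, since `φ` vanishes at `±L`, and `|φ| ≤ 1` bounds the
rest. A test function is only continuous with an `L²` weak derivative, so it is first identified
with its absolutely continuous representative. -/
theorem V0_le (hL : 0 < L) {z : X L} (hz : MemH1 z) :
    V0 z ≤ ((∫ x, |weakDeriv z x| ∂(vol L) : ℝ) : EReal) := by
  refine sSup_le ?_
  rintro _ ⟨φ, φ', hφ, hc, hs, hb, hw, rfl⟩
  rw [EReal.coe_le_coe_iff]
  have hm : MemLp φ 2 (vol L) :=
    (hφ.memLp_of_hasCompactSupport hc : MemLp φ 2 volume).restrict _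
  obtain ⟨h1, h2⟩ := (hw.congr hm.coeFn_toLp.symm (ae_eq_refl φ')).memH1
  obtain ⟨H, hH, hφH, hHd⟩ := h1.exists_ac hL
  rw [h2] at hHd
  have heq := eqOn_Icc_of_ae_eq hL hφ.continuousOn (hH.continuousOn_Icc hL)
    (hm.coeFn_toLp.symm.trans hφH)
  obtain ⟨e1, e2⟩ := eq_zero_of_tsupport_subset hs
  obtain ⟨F, hF, hzF, hFd⟩ := hz.exists_ac hL
  have hparts := hF.integral_by_parts hL hH hFd hHd
  rw [← heq ⟨by linarith, le_refl L⟩, ← heq ⟨le_refl (-L), by linarith⟩, e1, e2] at hparts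
  have h3 : ∫ x, z x * φ' x ∂(vol L) = ∫ x, F x * φ' x ∂(vol L) :=
    integral_congr_ae (hzF.mono fun x hx => by simp only [hx])
  rw [h3, hparts, mul_zero, mul_zero, sub_zero, zero_sub]
  refine (neg_le_abs _).trans ?_
  rw [← Real.norm_eq_abs]
  refine norm_integral_le_of_norm_le (X_integrable _).abs ?_
  filter_upwards [hφH, hm.coeFn_toLp] with x hx hx'
  rw [← hx, hx', norm_mul]
  exact mul_le_of_le_one_right (abs_nonneg _) (hb x)

/-- The ideal test function is minus the sign of `∂ₓz`, written as a quotient with `0/0 = 0`. It is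
cut off to `[-r, r]` and mollified, which preserves the bound `1`; dominated convergence removes the
mollification. -/
theorem setIntegral_abs_le_V0 (hL : 0 < L) {z : X L} (hz : MemH1 z) {r : ℝ} (hrL : r < L) :
    ((∫ x, (Icc (-r) r).indicator (fun x => |weakDeriv z x|) x ∂(vol L) : ℝ) : EReal)
      ≤ V0 z := by
  set σ : ℝ → ℝ := (Icc (-r) r).indicator fun x => -(weakDeriv z x / |weakDeriv z x|) with hσ
  have hzm : Measurable (weakDeriv z) := (Lp.stronglyMeasurable _).measurable
  have hσm : Measurable σ := (hzm.div hzm.abs).neg.indicator measurableSet_Icc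
  have hσ1 : ∀ x, |σ x| ≤ 1 := by
    intro x
    rw [hσ, indicator_apply]
    split_ifs
    · rw [abs_neg, abs_div, abs_abs]; exact div_self_le_one _
    · simp
  have hσloc : LocallyIntegrable σ volume :=
    (locallyIntegrable_const (1 : ℝ)).mono hσm.aestronglyMeasurable
      (Eventually.of_forall fun x => by simpa using hσ1 x)
  have hd : 0 < (L - r) / 2 := by linarith
  -- Radii at most `(L - r)/2` keep the supports inside `Ω`; the fixed ratio `2` of outer to inner
  -- radius is what the almost everywhere convergence requires.
  let B : ℕ → ContDiffBump (0 : ℝ) := fun k =>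
    ⟨(L - r) / 2 * (1 / ((k : ℝ) + 1)) / 2, (L - r) / 2 * (1 / ((k : ℝ) + 1)), by positivity,
      half_lt_self (by positivity)⟩
  have hBout : ∀ k, (B k).rOut ≤ (L - r) / 2 := fun k => by
    have : 1 / ((k : ℝ) + 1) ≤ 1 := by
      rw [div_le_one (by positivity)]; linarith [Nat.cast_nonneg (α := ℝ) k]
    simpa [B] using mul_le_mul_of_nonneg_left this hd.le
  have hBlim : Tendsto (fun k => (B k).rOut) atTop (𝓝 0) := by
    have := (tendsto_one_div_add_atTop_nhds_zero_nat (𝕜 := ℝ)).const_mul ((L - r) / 2)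
    rwa [mul_zero] at this
  set φ : ℕ → ℝ → ℝ := fun k =>
    convolution ((B k).normed volume) σ (ContinuousLinearMap.lsmul ℝ ℝ) volume with hφ
  have hφlim : ∀ᵐ x, Tendsto (fun k => φ k x) atTop (𝓝 (σ x)) :=
    ContDiffBump.ae_convolution_tendsto_right_of_locallyIntegrable (K := 2) hBlim
      (Eventually.of_forall fun k => by simp only [B]; linarith) hσloc
  have hφsm : ∀ k, ContDiff ℝ ∞ (φ k) := fun k =>
    (B k).hasCompactSupport_normed.contDiff_convolution_left _ (B k).contDiff_normed hσloc
  have hφ1 : ∀ k x, |φ k x| ≤ 1 := by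
    intro k x
    rw [← (B k).integral_normed (μ := volume), ← Real.norm_eq_abs]
    refine norm_integral_le_of_norm_le (B k).integrable_normed
      (Eventually.of_forall fun t => ?_)
    rw [ContinuousLinearMap.lsmul_apply, norm_smul,
      Real.norm_of_nonneg ((B k).nonneg_normed t)]
    exact mul_le_of_le_one_right ((B k).nonneg_normed t) (hσ1 _)
  have hφs : ∀ k, tsupport (φ k) ⊆ Icc (-((L + r) / 2)) ((L + r) / 2) := by
    intro k
    refine closure_minimal (fun x hx => ?_) isClosed_Icc
    obtain ⟨t, ht, y, hy, rfl⟩ := support_convolution_subset _ hx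
    rw [(B k).support_normed_eq, Real.ball_eq_Ioo] at ht
    have hy' : y ∈ Icc (-r) r := by
      by_contra h; exact hy (indicator_of_notMem h _)
    have := hBout k
    exact ⟨by simp only; linarith [ht.1, hy'.1], by simp only; linarith [ht.2, hy'.2]⟩
  have hφc : ∀ k, HasCompactSupport (φ k) := fun k =>
    isCompact_Icc.of_isClosed_subset (isClosed_tsupport _) (hφs k)
  have hφs' : ∀ k, tsupport (φ k) ⊆ Ioo (-L) L := fun k =>
    (hφs k).trans (Icc_subset_Ioo (by linarith) (by linarith))
  have hle : ∀ k, ((-∫ x, weakDeriv z x * φ k x ∂(vol L) : ℝ) : EReal) ≤ V0 z := by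
    intro k
    have hdc : Continuous (deriv (φ k)) := (hφsm k).continuous_deriv (by exact_mod_cast le_top)
    have hm : MemLp (deriv (φ k)) 2 (vol L) :=
      (hdc.memLp_of_hasCompactSupport (hφc k).deriv : MemLp (deriv (φ k)) 2 volume).restrict _
    refine le_sSup ⟨φ k, hm.toLp _, (hφsm k).continuous, hφc k, hφs' k, hφ1 k,
      (ac_of_contDiff (hφsm k)).isWeakDeriv hL hm.coeFn_toLp.symm, ?_⟩
    rw [← isWeakDeriv_weakDeriv hz (φ k) (hφsm k) (hφc k) (hφs' k)]
    congr 1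
    exact integral_congr_ae (hm.coeFn_toLp.mono fun x hx => by simp only [hx])
  have hlim : Tendsto (fun k => ∫ x, weakDeriv z x * φ k x ∂(vol L)) atTop
      (𝓝 (∫ x, weakDeriv z x * σ x ∂(vol L))) := by
    refine tendsto_integral_of_dominated_convergence (fun x => |weakDeriv z x|)
      (fun k => (Lp.aestronglyMeasurable _).mul (hφsm k).continuous.aestronglyMeasurable)
      (X_integrable _).abs (fun k => Eventually.of_forall fun x => ?_) ?_
    · rw [norm_mul]
      exact mul_le_of_le_one_right (abs_nonneg _) (hφ1 k x)
    · filter_upwards [ae_restrict_of_ae hφlim] with x hx using hx.const_mul _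
  have hval : -∫ x, weakDeriv z x * σ x ∂(vol L)
      = ∫ x, (Icc (-r) r).indicator (fun x => |weakDeriv z x|) x ∂(vol L) := by
    rw [← integral_neg]
    congr 1
    funext x
    rw [hσ, indicator_apply, indicator_apply]
    split_ifs
    · by_cases h0 : weakDeriv z x = 0
      · simp [h0]
      · have : |weakDeriv z x| ≠ 0 := abs_ne_zero.2 h0
        field_simp
        rw [sq_abs]
    · simp
  rw [← hval]
  exact le_of_tendsto' ((continuous_coe_real_ereal.tendsto _).comp hlim.neg) hle

/-- The total variation of a function in `H¹(Ω)`. -/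
theorem V0_eq (hL : 0 < L) {z : X L} (hz : MemH1 z) :
    V0 z = ((∫ x, |weakDeriv z x| ∂(vol L) : ℝ) : EReal) := by
  refine le_antisymm (V0_le hL hz) ?_
  have hlim : Tendsto (fun k : ℕ => ∫ x,
      (Icc (-(L - 1 / ((k : ℝ) + 1))) (L - 1 / ((k : ℝ) + 1))).indicator
        (fun x => |weakDeriv z x|) x ∂(vol L)) atTop
      (𝓝 (∫ x, |weakDeriv z x| ∂(vol L))) := by
    refine tendsto_integral_of_dominated_convergence (fun x => |weakDeriv z x|)
      (fun k => (X_integrable (weakDeriv z)).abs.aestronglyMeasurable.indicator measurableSet_Icc)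
      (X_integrable _).abs (fun k => Eventually.of_forall fun x => ?_) ?_
    · rw [indicator_apply]
      split_ifs
      · rw [Real.norm_eq_abs, abs_abs]
      · simp
    · filter_upwards [ae_vol_mem] with x hx
      refine tendsto_const_nhds.congr' ?_
      have h1 : ∀ᶠ k : ℕ in atTop, 1 / ((k : ℝ) + 1) < L - |x| :=
        (tendsto_one_div_add_atTop_nhds_zero_nat (𝕜 := ℝ)).eventually_lt_const
          (sub_pos.2 (abs_lt.2 hx))
      filter_upwards [h1] with k hk
      rw [indicator_of_mem]
      exact abs_le.1 (by linarith)
  refine le_of_tendsto' ((continuous_coe_real_ereal.tendsto _).comp hlim) fun k => ?_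
  exact setIntegral_abs_le_V0 hL hz (sub_lt_self _ Nat.one_div_pos_of_nat)

end TotalVariation

/-! ### One time step: uniqueness, existence, regularity -/

section Step

variable {L : ℝ}

theorem MemH1.sub {z y : X L} (hz : MemH1 z) (hy : MemH1 y) :
    MemH1 (z - y) ∧ weakDeriv (z - y) = weakDeriv z - weakDeriv y := by
  refine IsWeakDeriv.memH1 fun φ hφ hc hs => ?_
  have h1 := isWeakDeriv_weakDeriv hz φ hφ hc hs
  have h2 := isWeakDeriv_weakDeriv hy φ hφ hc hs
  have hdc : Continuous (deriv φ) := hφ.continuous_deriv (by exact_mod_cast le_top)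
  have e : ∀ a b : X L, ∀ ψ : ℝ → ℝ, Continuous ψ → HasCompactSupport ψ →
      ∫ x, (a - b : X L) x * ψ x ∂(vol L)
        = ∫ x, a x * ψ x ∂(vol L) - ∫ x, b x * ψ x ∂(vol L) := by
    intro a b ψ hψ hψc
    rw [← integral_sub (integrable_mul_test (X_integrable a) hψ hψc)
      (integrable_mul_test (X_integrable b) hψ hψc)]
    refine integral_congr_ae ((Lp.coeFn_sub a b).mono fun x hx => ?_)
    simp only [hx, Pi.sub_apply, sub_mul]
  rw [e _ _ _ hdc hc.deriv, e _ _ _ hφ.continuous hc, h1, h2]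
  ring

/-- The weak form of `p' = q` with `p(±L) = 0`. -/
theorem forall_memH1_iff (hL : 0 < L) {q p : X L} :
    (∀ φ : X L, MemH1 φ → (inner ℝ q φ : ℝ) + inner ℝ p (weakDeriv φ) = 0) ↔
      ∫ x, q x ∂(vol L) = 0 ∧ p = primL L hL q := by
  have hparts : ∫ x, q x ∂(vol L) = 0 → ∀ φ : X L, MemH1 φ →
      (inner ℝ (primL L hL q) (weakDeriv φ) : ℝ) = -inner ℝ q φ := by
    intro h0 φ hφ
    obtain ⟨F, hF, hφF, hFd⟩ := hφ.exists_ac hL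
    have h1 := (ac_prim hL (X_integrable q)).integral_by_parts hL hF
      (deriv_prim hL (X_integrable q)) hFd
    rw [prim_left, prim_right hL, h0, zero_mul, zero_mul, sub_zero, zero_sub] at h1
    rw [inner_eq_integral, inner_eq_integral,
      integral_congr_ae (hφF.mono fun x hx => by simp only [hx]
        : (fun x => q x * φ x) =ᵐ[vol L] fun x => q x * F x), ← h1]
    exact integral_congr_ae ((coeFn_primL hL q).mono fun x hx => by simp only [hx])
  constructor
  · intro h
    -- Testing with the constant `1` gives the mean; testing with primitives of arbitrary `ψ ∈
    -- L²(Ω)` then determines `p`.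
    have h0 : ∫ x, q x ∂(vol L) = 0 := by
      have := h _ (memH1_one hL).1
      rwa [(memH1_one hL).2, inner_zero_right, add_zero, real_inner_comm, inner_one] at this
    refine ⟨h0, ext_inner_right ℝ fun ψ => ?_⟩
    have h1 := h _ (memH1_primL hL ψ).1
    have h2 := hparts h0 _ (memH1_primL hL ψ).1
    rw [(memH1_primL hL ψ).2] at h1 h2
    linarith
  · rintro ⟨h0, rfl⟩ φ hφ
    rw [hparts h0 φ hφ]
    ring

/-- `w` solves one step of the state system with predecessor `v` and forcing term `u`. -/
def IsStep (τ ν Mu : ℝ) (f K : ℝ → ℝ → ℝ) (g : ℝ → ℝ) (ε δ : ℝ) (u v w : X L) : Prop :=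
  MemH1 w ∧ ∃ ϖ ξ : X L,
    (∀ᵐ x ∂(vol L), ϖ x ∈ subdiff (fun r : ℝ => ((f ε r : ℝ) : EReal)) (weakDeriv w x)) ∧
    (∀ᵐ x ∂(vol L), ξ x ∈ Kset K δ (w x)) ∧
    ∀ φ : X L, MemH1 φ →
      ∫ x, ((1 / τ * (w x - v x) + ξ x + g (w x)) * φ x
        + (ϖ x + ν ^ 2 * weakDeriv w x) * weakDeriv φ x) ∂(vol L)
        = ∫ x, Mu * u x * φ x ∂(vol L)

variable {τ ν Mu : ℝ} {f Kh K : ℝ → ℝ → ℝ} {g G : ℝ → ℝ} {Cg ε δ : ℝ} {u v w : X L}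

theorem integrable_mul_add_mul (a b c d : X L) :
    Integrable (fun x => a x * b x + c x * d x) (vol L) :=
  (integrable_mul a b).add (integrable_mul c d)

theorem inner_add_inner_eq_integral (a b c d : X L) :
    (inner ℝ a b : ℝ) + inner ℝ c d = ∫ x, (a x * b x + c x * d x) ∂(vol L) := by
  rw [inner_eq_integral, inner_eq_integral,
    integral_add (integrable_mul a b) (integrable_mul c d)]

theorem weak_form_iff {ϖ ξ q p φ : X L}
    (hq : ∀ᵐ x ∂(vol L), q x = 1 / τ * (w x - v x) + ξ x + g (w x) - Mu * u x)
    (hp : ∀ᵐ x ∂(vol L), p x = ϖ x + ν ^ 2 * weakDeriv w x) :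
    (∫ x, ((1 / τ * (w x - v x) + ξ x + g (w x)) * φ x
        + (ϖ x + ν ^ 2 * weakDeriv w x) * weakDeriv φ x) ∂(vol L)
        = ∫ x, Mu * u x * φ x ∂(vol L)) ↔
      (inner ℝ q φ : ℝ) + inner ℝ p (weakDeriv φ) = 0 := by
  have hu : Integrable (fun x => Mu * u x * φ x) (vol L) := by
    simpa only [mul_assoc] using (integrable_mul u φ).const_mul Mu
  have h1 : ∫ x, ((1 / τ * (w x - v x) + ξ x + g (w x)) * φ x
        + (ϖ x + ν ^ 2 * weakDeriv w x) * weakDeriv φ x) ∂(vol L)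
      = ∫ x, (q x * φ x + Mu * u x * φ x + p x * weakDeriv φ x) ∂(vol L) := by
    refine integral_congr_ae ?_
    filter_upwards [hq, hp] with x e1 e2
    rw [e1, e2]; ring
  have i1 : Integrable (fun x => q x * φ x + Mu * u x * φ x) (vol L) :=
    (integrable_mul q φ).add hu
  rw [h1, integral_add i1 (integrable_mul p _), integral_add (integrable_mul q φ) hu,
    ← inner_eq_integral, ← inner_eq_integral]
  constructor <;> intro h <;> linarith

/-- Rewrites the step as `p' = q` with `p(±L) = 0` in weak form. `H¹` functions are bounded in one
dimension, so `g(w)` is in `L²` without any growth condition on `g`. -/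
theorem IsStep.exists_flux (hL : 0 < L) (hg : IsPerturbation g G Cg)
    (h : IsStep τ ν Mu f K g ε δ u v w) :
    ∃ ϖ ξ q p : X L,
      (∀ᵐ x ∂(vol L), ϖ x ∈ subdiff (fun r : ℝ => ((f ε r : ℝ) : EReal)) (weakDeriv w x)) ∧
      (∀ᵐ x ∂(vol L), ξ x ∈ Kset K δ (w x)) ∧
      (∀ᵐ x ∂(vol L), q x = 1 / τ * (w x - v x) + ξ x + g (w x) - Mu * u x) ∧
      (∀ᵐ x ∂(vol L), p x = ϖ x + ν ^ 2 * weakDeriv w x) ∧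
      ∀ φ : X L, MemH1 φ → (inner ℝ q φ : ℝ) + inner ℝ p (weakDeriv φ) = 0 := by
  obtain ⟨hw, ϖ, ξ, h1, h2, h3⟩ := h
  have hgw : MemLp (fun x => g (w x)) 2 (vol L) :=
    (hw.memLp_top_comp hL hg.contDiff_g.continuous).mono_exponent le_top
  have hq : MemLp (fun x => 1 / τ * (w x - v x) + ξ x + g (w x) - Mu * u x) 2 (vol L) :=
    (((((Lp.memLp w).sub (Lp.memLp v)).const_mul (1 / τ)).add (Lp.memLp ξ)).add hgw).sub
      ((Lp.memLp u).const_mul Mu)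
  have hp : MemLp (fun x => ϖ x + ν ^ 2 * weakDeriv w x) 2 (vol L) :=
    (Lp.memLp ϖ).add ((Lp.memLp _).const_mul _)
  exact ⟨ϖ, ξ, hq.toLp _, hp.toLp _, h1, h2, hq.coeFn_toLp, hp.coeFn_toLp, fun φ hφ =>
    (weak_form_iff hq.coeFn_toLp hp.coeFn_toLp).1 (h3 φ hφ)⟩

theorem IsPerturbation.mul_sub_nonneg (hg : IsPerturbation g G Cg) (x y : ℝ) :
    -(Cg * (x - y) ^ 2) ≤ (g x - g y) * (x - y) := by
  have h : 0 ≤ ((g x + Cg * x) - (g y + Cg * y)) * (x - y) := by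
    rcases le_total x y with h | h
    · exact mul_nonneg_of_nonpos_of_nonpos (sub_nonpos.2 (hg.semimonotone h)) (sub_nonpos.2 h)
    · exact mul_nonneg (sub_nonneg.2 (hg.semimonotone h)) (sub_nonneg.2 h)
  linarith

/-- Semi-monotonicity makes `G + C_g r²/2` convex, and this is its tangent inequality. The quadratic
loss is absorbed by the time step. -/
theorem IsPerturbation.le_mul_sub (hg : IsPerturbation g G Cg) (x y : ℝ) :
    G x - G y - Cg / 2 * (x - y) ^ 2 ≤ g x * (x - y) := by
  have hd : ∀ r, HasDerivAt (fun r => G r + Cg / 2 * r ^ 2) (g r + Cg * r) r := fun r => by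
    refine ((hg.hasDerivAt r).add (((hasDerivAt_id r).pow 2).const_mul (Cg / 2))).congr_deriv ?_
    simp; ring
  have hconv : ConvexOn ℝ univ fun r => G r + Cg / 2 * r ^ 2 := by
    refine Monotone.convexOn_univ_of_deriv (fun r => (hd r).differentiableAt) ?_
    rw [funext fun r => (hd r).deriv]
    exact hg.semimonotone
  have := tangent_le_of_convexOn hconv (hd x) y
  nlinarith

/-- Uniqueness for one step. -/
theorem IsStep.unique (hL : 0 < L) (hg : IsPerturbation g G Cg)
    (hK : IsRegularizationIndicator Kh K) (hδ : δ ∈ Icc (0 : ℝ) 1) (hCg : Cg < 1 / τ)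
    {w' : X L} (h : IsStep τ ν Mu f K g ε δ u v w) (h' : IsStep τ ν Mu f K g ε δ u v w') :
    w = w' := by
  obtain ⟨ϖ, ξ, q, p, h1, h2, h3, h4, h5⟩ := h.exists_flux hL hg
  obtain ⟨ϖ', ξ', q', p', h1', h2', h3', h4', h5'⟩ := h'.exists_flux hL hg
  obtain ⟨hd, hd'⟩ := h.1.sub h'.1
  have e1 := h5 _ hd
  have e2 := h5' _ hd
  have e3 : ∫ x, ((q x - q' x) * (w - w' : X L) x
      + (p x - p' x) * weakDeriv (w - w') x) ∂(vol L) = 0 := by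
    rw [inner_add_inner_eq_integral] at e1 e2
    have : (fun x => (q x - q' x) * (w - w' : X L) x + (p x - p' x) * weakDeriv (w - w') x)
        = fun x => (q x * (w - w' : X L) x + p x * weakDeriv (w - w') x)
          - (q' x * (w - w' : X L) x + p' x * weakDeriv (w - w') x) := by
      funext x; ring
    rw [this, integral_sub (integrable_mul_add_mul _ _ _ _) (integrable_mul_add_mul _ _ _ _),
      e1, e2, sub_zero]
  -- The contributions of `ϖ`, `ξ` and `ν² ∂ₓw` are nonnegative and are dropped; `g` costs at most
  -- `Cg`.
  have e4 : ∫ x, (1 / τ - Cg) * ((w - w' : X L) x * (w - w' : X L) x) ∂(vol L) ≤ 0 := by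
    rw [← e3]
    refine integral_mono_ae ((integrable_mul _ _).const_mul _) ?_ ?_
    · have i : ∀ a b c : X L, Integrable (fun x => (a x - b x) * c x) (vol L) := fun a b c =>
        ((integrable_mul a c).sub (integrable_mul b c)).congr
          (Eventually.of_forall fun x => (sub_mul _ _ _).symm)
      exact (i _ _ _).add (i _ _ _)
    · filter_upwards [h1, h2, h3, h4, h1', h2', h3', h4', Lp.coeFn_sub w w',
        Lp.coeFn_sub (weakDeriv w) (weakDeriv w')] with x a1 a2 a3 a4 b1 b2 b3 b4 c1 c2
      rw [hd', c1, c2, Pi.sub_apply, Pi.sub_apply, a3, a4, b3, b4]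
      have m1 := subdiff_coe_monotone a1 b1
      have m2 := Kset_monotone hK hδ a2 b2
      have m3 := hg.mul_sub_nonneg (w x) (w' x)
      have m4 : 0 ≤ ν ^ 2 * (weakDeriv w x - weakDeriv w' x) ^ 2 := by positivity
      linarith
  rw [integral_const_mul, ← inner_eq_integral, real_inner_self_eq_norm_sq] at e4
  have e5 : ‖w - w'‖ ^ 2 ≤ 0 := by
    by_contra! hc
    have : 0 < (1 / τ - Cg) * ‖w - w'‖ ^ 2 := mul_pos (by linarith) hc
    linarith
  exact sub_eq_zero.1 (norm_eq_zero.1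
    (pow_eq_zero_iff two_ne_zero |>.1 (le_antisymm e5 (sq_nonneg _))))

/-- Existence for one step. -/
theorem exists_isStep (hL : 0 < L) (hν : 0 < ν) (hf : IsRegularizationAbs f)
    (hg : IsPerturbation g G Cg) (hK : IsRegularizationIndicator Kh K)
    (hε : ε ∈ Icc (0 : ℝ) 1) (hδ : δ ∈ Icc (0 : ℝ) 1) (hCg : Cg < 1 / τ) (u v : X L) :
    ∃ w, IsStep τ ν Mu f K g ε δ u v w := by
  have hν2 : 0 < ν ^ 2 := by positivity
  obtain ⟨J, hJ0, hJm, ⟨CJ, hJl⟩, hJ, -⟩ := hf.exists_resolvent hε hν2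
  obtain ⟨R, hRm, ⟨CR, hRl⟩, hR⟩ := hK.exists_resolvent hδ (b := fun r => 1 / τ * r + g r)
    ((continuous_const.mul continuous_id).add hg.contDiff_g.continuous)
    (sub_pos.2 hCg) (fun x y => by
      have := hg.mul_sub_nonneg x y
      nlinarith)
  -- All known data go into `h`; the selections `ϖ` and `ξ` are then read off from `p = primL L hL
  -- q` and `s`.
  set h : X L := (1 / τ) • v + Mu • u with hh
  obtain ⟨s, w, h1, h2, h3, h4⟩ := exists_stationary hL hRm hRl hJm hJl hJ0 h
  set q : X L := s - h with hq
  have hgw : MemLp (fun x => g (w x)) 2 (vol L) :=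
    (h3.memLp_top_comp hL hg.contDiff_g.continuous).mono_exponent le_top
  have hξ : MemLp (fun x => s x - (1 / τ * w x + g (w x))) 2 (vol L) :=
    (Lp.memLp s).sub (((Lp.memLp w).const_mul _).add hgw)
  have hϖ : MemLp (fun x => primL L hL q x - ν ^ 2 * weakDeriv w x) 2 (vol L) :=
    (Lp.memLp _).sub ((Lp.memLp _).const_mul _)
  refine ⟨w, h3, hϖ.toLp _, hξ.toLp _, ?_, ?_, fun φ hφ => ?_⟩
  · filter_upwards [hϖ.coeFn_toLp, coeFn_primL hL q, h4] with x e1 e2 e3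
    rw [e1, e2, e3]
    exact hJ _
  · filter_upwards [hξ.coeFn_toLp, h2] with x e1 e2
    rw [e1, e2]
    exact hR _
  · refine (weak_form_iff (q := q) (p := primL L hL q) ?_ ?_).2
      ((forall_memH1_iff hL).2 ⟨h1, rfl⟩ φ hφ)
    · filter_upwards [hξ.coeFn_toLp, Lp.coeFn_sub s h, Lp.coeFn_add ((1 / τ) • v) (Mu • u),
        Lp.coeFn_smul (1 / τ) v, Lp.coeFn_smul Mu u] with x e1 e2 e3 e4 e5
      rw [hq, e2, Pi.sub_apply, hh, e3, Pi.add_apply, e4, e5, e1]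
      simp only [Pi.smul_apply, smul_eq_mul]
      ring
    · filter_upwards [hϖ.coeFn_toLp] with x e1
      rw [e1]; ring

/-- Regularity, boundary condition and pointwise form of the equation for one step. -/
theorem IsStep.regularity (hL : 0 < L) (hν : 0 < ν) (hf : IsRegularizationAbs f)
    (hg : IsPerturbation g G Cg) (hε : ε ∈ Icc (0 : ℝ) 1)
    (h : IsStep τ ν Mu f K g ε δ u v w) :
    (MemH2 w ∧ VanishesAtBoundary (weakDeriv w)) ∧ ∃ ϖ ξ : X L,
      MemH1 ϖ ∧ MemLp ϖ ⊤ (vol L) ∧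
      (∀ᵐ x ∂(vol L), 1 / τ * (w x - v x) - weakDeriv ϖ x
        - ν ^ 2 * weakDeriv (weakDeriv w) x + ξ x + g (w x) = Mu * u x) ∧
      (∀ᵐ x ∂(vol L), ϖ x ∈ subdiff (fun r : ℝ => ((f ε r : ℝ) : EReal)) (weakDeriv w x)) ∧
      (∀ᵐ x ∂(vol L), ξ x ∈ Kset K δ (w x)) := by
  have hν2 : 0 < ν ^ 2 := by positivity
  obtain ⟨J, hJ0, hJm, ⟨CJ, hJl⟩, -, hJu⟩ := hf.exists_resolvent hε hν2
  obtain ⟨ϖ, ξ, q, p, h1, h2, h3, h4, h5⟩ := h.exists_flux hL hg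
  obtain ⟨hq0, hp⟩ := (forall_memH1_iff hL).1 h5
  have hP := ac_prim hL (X_integrable q)
  have hPd := deriv_prim hL (X_integrable q)
  have hpP : ∀ᵐ x ∂(vol L), ϖ x + ν ^ 2 * weakDeriv w x = prim L q x := by
    filter_upwards [h4, coeFn_primL hL q] with x e1 e2
    rw [← e1, hp, e2]
  -- Inverting `∂f^ε + ν²` writes `∂ₓw` as a Lipschitz function of the flux, although `∂f^ε` may be
  -- multivalued.
  have hwJ : ∀ᵐ x ∂(vol L), weakDeriv w x = J (prim L q x) := by
    filter_upwards [hpP, h1] with x e1 e2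
    refine hJu _ _ ?_
    rwa [← e1, add_sub_cancel_right]
  have hJP : AC L fun x => J (prim L q x) := absolutelyContinuousOnInterval_comp hJl hP
  have hJPd : MemLp (deriv fun x => J (prim L q x)) 2 (vol L) :=
    hP.deriv_comp_memLp hL ((memLp_congr_ae hPd).2 (Lp.memLp q)) hJl
  obtain ⟨k1, k2⟩ := hJP.memH1 hL hwJ hJPd.coeFn_toLp.symm
  have hϖF : ∀ᵐ x ∂(vol L), ϖ x = prim L q x - ν ^ 2 * J (prim L q x) := by
    filter_upwards [hpP, hwJ] with x e1 e2
    rw [← e2]; linarith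
  have hF : AC L fun x => prim L q x - ν ^ 2 * J (prim L q x) :=
    AbsolutelyContinuousOnInterval.sub hP (AbsolutelyContinuousOnInterval.const_mul _ hJP)
  obtain ⟨k3, k4⟩ := hF.memH1 hL hϖF (q := q - ν ^ 2 • hJPd.toLp _) (by
    filter_upwards [hP.ae_differentiableAt hL, hJP.ae_differentiableAt hL, hPd,
      hJPd.coeFn_toLp, Lp.coeFn_sub q (ν ^ 2 • hJPd.toLp _),
      Lp.coeFn_smul (ν ^ 2) (hJPd.toLp _)] with x e1 e2 e3 e4 e5 e6
    rw [e5, Pi.sub_apply, e6, Pi.smul_apply, e4, smul_eq_mul,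
      (e1.hasDerivAt.fun_sub (e2.hasDerivAt.const_mul (ν ^ 2))).deriv, e3])
  refine ⟨⟨⟨h.1, k1⟩, _, hJP.continuousOn_Icc hL, hwJ, ?_, ?_⟩, ϖ, ξ, k3,
    (memLp_congr_ae hϖF).2 (hF.memLp_top hL), ?_, h1, h2⟩
  · rw [prim_left, hJ0]
  · rw [prim_right hL, hq0, hJ0]
  · filter_upwards [h3, Lp.coeFn_sub q (ν ^ 2 • hJPd.toLp _),
      Lp.coeFn_smul (ν ^ 2) (hJPd.toLp _)] with x e1 e2 e3
    rw [k4, k2, e2, Pi.sub_apply, e3, Pi.smul_apply, smul_eq_mul]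
    linarith

end Step

/-! ### Free energies and the energy inequality -/

section Energy

variable {L τ ν Mu : ℝ} {f Kh K : ℝ → ℝ → ℝ} {g G : ℝ → ℝ} {Cg ε δ : ℝ} {u v w : X L}

theorem intFunctional_coe {φ : ℝ → ℝ} {z : X L} (h : Integrable (fun x => φ (z x)) (vol L)) :
    intFunctional (fun r => ((φ r : ℝ) : EReal)) z
      = ((∫ x, φ (z x) ∂(vol L) : ℝ) : EReal) := by
  have hI : InL1 (fun r => ((φ r : ℝ) : EReal)) z :=
    ⟨Eventually.of_forall fun x => ⟨EReal.coe_ne_top _, EReal.coe_ne_bot _⟩, by simpa using h⟩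
  rw [intFunctional, if_pos hI]
  simp only [EReal.toReal_coe]

theorem IsRegularizationAbs.integrable_comp (hf : IsRegularizationAbs f)
    (hε : ε ∈ Icc (0 : ℝ) 1) (z : X L) : Integrable (fun x => f ε (z x)) (vol L) := by
  obtain ⟨C, hC⟩ := hf.quadratic_growth hε
  refine (((integrable_const (1 : ℝ)).add (Lp.memLp z).integrable_sq).const_mul C).mono'
    ((hf.continuous hε).comp_aestronglyMeasurable (Lp.aestronglyMeasurable z))
    (Eventually.of_forall fun x => ?_)
  rw [Real.norm_of_nonneg (hf.apply_nonneg hε _)]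
  exact hC _

/-- Merges the two branches of `Phi`: for `ε = 0` the supremum `V0` is `∫ |∂ₓz|`, and `f 0 = |·|`.
-/
theorem Phi_eq (hL : 0 < L) (hf : IsRegularizationAbs f) (hε : ε ∈ Icc (0 : ℝ) 1) {z : X L}
    (hz : MemH1 z) :
    Phi ν f ε z = ((∫ x, f ε (weakDeriv z x) ∂(vol L)
      + ν ^ 2 / 2 * ∫ x, (weakDeriv z x) ^ 2 ∂(vol L) : ℝ) : EReal) := by
  rw [EReal.coe_add, Phi]
  split_ifs with h
  · subst h
    rw [V0_eq hL hz, VD, if_pos hz]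
    simp only [hf.zero]
  · rw [intFunctional_coe (hf.integrable_comp hε _)]

theorem freeEnergy_eq (hL : 0 < L) (hf : IsRegularizationAbs f) (hε : ε ∈ Icc (0 : ℝ) 1)
    (hg : IsPerturbation g G Cg) {z : X L} (hz : MemH1 z) (hK : InL1 (KhatE Kh δ) z) :
    freeEnergy ν f Kh G ε δ z = ((∫ x, f ε (weakDeriv z x) ∂(vol L)
      + ν ^ 2 / 2 * ∫ x, (weakDeriv z x) ^ 2 ∂(vol L)
      + ∫ x, (KhatE Kh δ (z x)).toReal ∂(vol L) + ∫ x, G (z x) ∂(vol L) : ℝ) : EReal) := by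
  have hG : Integrable (fun x => G (z x)) (vol L) :=
    (hz.memLp_top_comp hL hg.contDiff_G.continuous).integrable le_top
  rw [freeEnergy, Psi, if_pos hz, Phi_eq hL hf hε hz, intFunctional, if_pos hK,
    intFunctional_coe hG, ← EReal.coe_add, ← EReal.coe_add]

/-- A selection `ξ` exists for `δ = 0` only where `w ∈ [-1, 1]`; for `δ > 0` boundedness of `w`
suffices. This passes the integrability assumed of `w₀` on to every later step. -/
theorem inL1_KhatE (hL : 0 < L) (hK : IsRegularizationIndicator Kh K) (hδ : δ ∈ Icc (0 : ℝ) 1)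
    {ξ : X L} (hw : MemH1 w) (hξ : ∀ᵐ x ∂(vol L), ξ x ∈ Kset K δ (w x)) :
    InL1 (KhatE Kh δ) w := by
  rcases hδ.1.eq_or_lt with rfl | hpos
  · have h0 : ∀ᵐ x ∂(vol L), KhatE Kh 0 (w x) = 0 := by
      filter_upwards [hξ] with x hx
      rw [Kset_zero, mem_subdiff_indicatorI_iff] at hx
      rw [KhatE, if_pos rfl, indicatorI, if_pos hx.1]
    refine ⟨?_, (integrable_zero ℝ ℝ (vol L)).congr ?_⟩
    · filter_upwards [h0] with x hx
      rw [hx]; simp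
    · filter_upwards [h0] with x hx
      rw [hx]; simp
  · simp only [InL1, KhatE, if_neg hpos.ne', EReal.toReal_coe]
    exact ⟨Eventually.of_forall fun x => ⟨EReal.coe_ne_top _, EReal.coe_ne_bot _⟩,
      (hw.memLp_top_comp hL (hK.contDiff_Kh δ ⟨hpos, hδ.2⟩).continuous).integrable le_top⟩

/-- The subgradient inequality for `K̂^δ`. -/
theorem toReal_KhatE_sub_le (hK : IsRegularizationIndicator Kh K) (hδ : δ ∈ Icc (0 : ℝ) 1)
    {ξ x y : ℝ} (hξ : ξ ∈ Kset K δ x) (hy : KhatE Kh δ y ≠ ⊤) :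
    (KhatE Kh δ x).toReal - (KhatE Kh δ y).toReal ≤ ξ * (x - y) := by
  rcases hδ.1.eq_or_lt with rfl | hpos
  · rw [Kset_zero, mem_subdiff_indicatorI_iff] at hξ
    have hy' : y ∈ Icc (-1 : ℝ) 1 := by
      by_contra h
      exact hy (by rw [KhatE, if_pos rfl, indicatorI, if_neg h])
    rw [KhatE, KhatE, if_pos rfl, if_pos rfl, indicatorI, indicatorI, if_pos hξ.1, if_pos hy']
    have := hξ.2 y hy'
    simp only [EReal.toReal_zero, sub_self]
    linarith
  · have hδ' : δ ∈ Ioc (0 : ℝ) 1 := ⟨hpos, hδ.2⟩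
    rw [Kset_of_pos hδ', mem_singleton_iff] at hξ
    have := tangent_le_of_convexOn (hK.convexOn hδ') (hK.hasDerivAt δ hδ' x) y
    rw [KhatE, KhatE, if_neg hpos.ne', if_neg hpos.ne', EReal.toReal_coe, EReal.toReal_coe, hξ]
    linarith

/-- The energy inequality for one step. -/
theorem IsStep.energy_le (hL : 0 < L) (hf : IsRegularizationAbs f) (hε : ε ∈ Icc (0 : ℝ) 1)
    (hg : IsPerturbation g G Cg) (hK : IsRegularizationIndicator Kh K)
    (hδ : δ ∈ Icc (0 : ℝ) 1) (hτ : 0 < τ) (hCg : 2 * Cg * τ ≤ 1) (hv : MemH1 v)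
    (hKv : InL1 (KhatE Kh δ) v) (h : IsStep τ ν Mu f K g ε δ u v w) :
    InL1 (KhatE Kh δ) w ∧ freeEnergy ν f Kh G ε δ v ≠ ⊤ ∧ freeEnergy ν f Kh G ε δ v ≠ ⊥ ∧
      freeEnergy ν f Kh G ε δ w ≠ ⊤ ∧ freeEnergy ν f Kh G ε δ w ≠ ⊥ ∧
      1 / (2 * τ) * ‖w - v‖ ^ 2 + (freeEnergy ν f Kh G ε δ w).toReal
        - (freeEnergy ν f Kh G ε δ v).toReal ≤ τ * Mu ^ 2 * ‖u‖ ^ 2 := by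
  obtain ⟨ϖ, ξ, q, p, h1, h2, h3, h4, h5⟩ := h.exists_flux hL hg
  have hKw : InL1 (KhatE Kh δ) w := inL1_KhatE hL hK hδ h.1 h2
  refine ⟨hKw, ?_⟩
  rw [freeEnergy_eq hL hf hε hg hv hKv, freeEnergy_eq hL hf hε hg h.1 hKw]
  refine ⟨EReal.coe_ne_top _, EReal.coe_ne_bot _, EReal.coe_ne_top _, EReal.coe_ne_bot _, ?_⟩
  rw [EReal.toReal_coe, EReal.toReal_coe]
  obtain ⟨hd, hd'⟩ := h.1.sub hv
  have e1 := h5 _ hd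
  rw [inner_add_inner_eq_integral] at e1
  set E : X L → ℝ → ℝ := fun z x => f ε (weakDeriv z x) + ν ^ 2 / 2 * (weakDeriv z x) ^ 2
    + (KhatE Kh δ (z x)).toReal + G (z x) with hE
  have hG : ∀ z : X L, MemH1 z → Integrable (fun x => G (z x)) (vol L) := fun z hz =>
    (hz.memLp_top_comp hL hg.contDiff_G.continuous).integrable le_top
  have iΦ : ∀ z : X L, Integrable
      (fun x => f ε (weakDeriv z x) + ν ^ 2 / 2 * (weakDeriv z x) ^ 2) (vol L) := fun z =>
    (hf.integrable_comp hε _).add ((Lp.memLp _).integrable_sq.const_mul _)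
  have iΨ : ∀ z : X L, InL1 (KhatE Kh δ) z → Integrable
      (fun x => f ε (weakDeriv z x) + ν ^ 2 / 2 * (weakDeriv z x) ^ 2
        + (KhatE Kh δ (z x)).toReal) (vol L) := fun z hz => (iΦ z).add hz.2
  have iE : ∀ z : X L, MemH1 z → InL1 (KhatE Kh δ) z → Integrable (E z) (vol L) :=
    fun z hz hzK => (iΨ z hzK).add (hG z hz)
  have hEint : ∀ z : X L, MemH1 z → InL1 (KhatE Kh δ) z → ∫ x, E z x ∂(vol L)
      = ∫ x, f ε (weakDeriv z x) ∂(vol L) + ν ^ 2 / 2 * ∫ x, (weakDeriv z x) ^ 2 ∂(vol L)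
        + ∫ x, (KhatE Kh δ (z x)).toReal ∂(vol L) + ∫ x, G (z x) ∂(vol L) := by
    intro z hz hzK
    rw [integral_add (iΨ z hzK) (hG z hz), integral_add (iΦ z) hzK.2,
      integral_add (hf.integrable_comp hε _) ((Lp.memLp _).integrable_sq.const_mul _),
      integral_const_mul]
  rw [← hEint v hv hKv, ← hEint w h.1 hKw, ← real_inner_self_eq_norm_sq,
    ← real_inner_self_eq_norm_sq, inner_eq_integral, inner_eq_integral, ← integral_const_mul,
    ← integral_const_mul]
  have iD := (integrable_mul (w - v) (w - v)).const_mul (1 / (2 * τ))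
  have iU := (integrable_mul u u).const_mul (τ * Mu ^ 2)
  have iDE : Integrable (fun x => 1 / (2 * τ) * ((w - v : X L) x * (w - v : X L) x) + E w x)
      (vol L) := iD.add (iE w h.1 hKw)
  have iL : Integrable (fun x => 1 / (2 * τ) * ((w - v : X L) x * (w - v : X L) x) + E w x
      - E v x) (vol L) := iDE.sub (iE v hv hKv)
  rw [← integral_add iD (iE w h.1 hKw), ← integral_sub iDE (iE v hv hKv)]
  have hle : ∫ x, (1 / (2 * τ) * ((w - v : X L) x * (w - v : X L) x) + E w x - E v x) ∂(vol L)
      ≤ ∫ x, ((q x * (w - v : X L) x + p x * weakDeriv (w - v) x)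
        + τ * Mu ^ 2 * (u x * u x)) ∂(vol L) := by
    refine integral_mono_ae iL ((integrable_mul_add_mul _ _ _ _).add iU) ?_
    filter_upwards [h1, h2, h3, h4, Lp.coeFn_sub w v,
      Lp.coeFn_sub (weakDeriv w) (weakDeriv v), hKv.1] with x a1 a2 a3 a4 c1 c2 a5
    rw [hd', c1, c2, Pi.sub_apply, Pi.sub_apply, a3, a4]
    have m1 := mem_subdiff_coe_iff.1 a1 (weakDeriv v x)
    have m2 := toReal_KhatE_sub_le hK hδ a2 a5.1
    have m3 := hg.le_mul_sub (w x) (v x)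
    have m4 : 0 ≤ ν ^ 2 * (weakDeriv w x - weakDeriv v x) ^ 2 := by positivity
    -- The coefficient `1/τ` is split as `1/(2τ) + 1/(4τ) + 1/(4τ)`: the first part stays in the
    -- estimate, the second pays for this Young inequality, the third for the loss `Cg/2`.
    have m5 : Mu * u x * (w x - v x) ≤ τ * Mu ^ 2 * (u x * u x)
        + 1 / (4 * τ) * (w x - v x) ^ 2 := by
      have : 0 ≤ τ * (Mu * u x - 1 / (2 * τ) * (w x - v x)) ^ 2 := by positivity
      have e : τ * (Mu * u x - 1 / (2 * τ) * (w x - v x)) ^ 2 = τ * Mu ^ 2 * (u x * u x)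
          + 1 / (4 * τ) * (w x - v x) ^ 2 - Mu * u x * (w x - v x) := by
        field_simp; ring
      linarith
    have m6 : Cg / 2 * (w x - v x) ^ 2 ≤ 1 / (4 * τ) * (w x - v x) ^ 2 := by
      refine mul_le_mul_of_nonneg_right ?_ (sq_nonneg _)
      rw [le_div_iff₀ (by positivity)]
      linarith
    have m7 : 1 / τ = 1 / (2 * τ) + 1 / (4 * τ) + 1 / (4 * τ) := by field_simp; norm_num
    simp only [hE, m7]
    nlinarith
  refine hle.trans_eq ?_
  rw [integral_add (integrable_mul_add_mul _ _ _ _) iU, e1, zero_add]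

end Energy

/-! ### Time stepping -/

section System

variable {L : ℝ} {n : ℕ}

theorem prev_zero (w₀ : X L) (w : Fin n → X L) (h : 0 < n) : prev w₀ w ⟨0, h⟩ = w₀ := rfl

theorem prev_succ (w₀ : X L) (w : Fin n → X L) {k : ℕ} (h : k + 1 < n) :
    prev w₀ w ⟨k + 1, h⟩ = w ⟨k, Nat.lt_of_succ_lt h⟩ := rfl

/-- Time-stepping: if every step is uniquely solvable, then so is the whole scheme. -/
theorem existsUnique_of_step {S : X L → X L → X L → Prop} (u : Fin n → X L) (w₀ : X L)
    (hex : ∀ u v, ∃ w, S u v w) (huniq : ∀ u v w w', S u v w → S u v w' → w = w') :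
    ∃! w : Fin n → X L, ∀ i, S (u i) (prev w₀ w i) (w i) := by
  choose s hs using hex
  -- The recursion runs over all of `ℕ`, frozen after step `n`, with `W k` as the predecessor of
  -- step `k`.
  let W : ℕ → X L := fun k =>
    Nat.rec w₀ (fun k z => if h : k < n then s (u ⟨k, h⟩) z else z) k
  have hW : ∀ k (h : k < n), W (k + 1) = s (u ⟨k, h⟩) (W k) := fun k h => dif_pos h
  have hprev : ∀ i : Fin n, prev w₀ (fun i : Fin n => W (i + 1)) i = W i := by
    rintro ⟨k, hk⟩
    cases k with
    | zero => rfl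
    | succ k => rfl
  refine ⟨fun i => W (i + 1), fun i => ?_, fun w hw => ?_⟩
  · simp only [hprev]
    rw [hW i i.2]
    exact hs _ _
  · have key : ∀ k (h : k < n), w ⟨k, h⟩ = W (k + 1) := by
      intro k
      induction k with
      | zero =>
        intro h
        have := hw ⟨0, h⟩
        rw [prev_zero] at this
        rw [hW 0 h]
        exact huniq _ _ _ _ this (hs _ _)
      | succ k ih =>
        intro h
        have := hw ⟨k + 1, h⟩
        rw [prev_succ, ih] at this
        rw [hW _ h]
        exact huniq _ _ _ _ this (hs _ _)
    exact funext fun i => key i i.2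

end System

end

end AllenCahn

/-! ### The main theorem -/

open AllenCahn in
theorem theorem1
    -- the interval `Ω = (-L, L)`, the constants `ν > 0`, `M_u ≥ 0`
    (L : ℝ) (hL : 0 < L) (ν : ℝ) (hν : 0 < ν) (Mu : ℝ) (hMu : 0 ≤ Mu)
    -- the nonlinearities
    (f : ℝ → ℝ → ℝ) (hf : IsRegularizationAbs f)
    (g G : ℝ → ℝ) (Cg : ℝ) (hg : IsPerturbation g G Cg)
    (Kh K : ℝ → ℝ → ℝ) (hK : IsRegularizationIndicator Kh K)
    -- the time step `τ = T / n < τ* = 1 / (8 (C_g + 1))`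
    (T : ℝ) (hT : 0 < T) (n : ℕ) (hn : 0 < n) (τ : ℝ) (hτ : τ = T / n)
    (hτ' : τ < 1 / (8 * (Cg + 1)))
    -- the parameters, the forcing term and the initial value
    (ε : ℝ) (hε : ε ∈ Set.Icc (0 : ℝ) 1) (δ : ℝ) (hδ : δ ∈ Set.Icc (0 : ℝ) 1)
    (u : Fin n → X L) (w₀ : X L) (hw₀ : MemH1 w₀) (hKw₀ : InL1 (KhatE Kh δ) w₀) :
    -- existence and uniqueness
    (∃! w : Fin n → X L, IsSolution τ ν Mu f K g ε δ u w₀ w) ∧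
    ∀ w : Fin n → X L, IsSolution τ ν Mu f K g ε δ u w₀ w →
      -- regularity and the Neumann boundary condition
      (∀ i, MemH2 (w i) ∧ VanishesAtBoundary (weakDeriv (w i))) ∧
      -- pointwise form of the equation
      (∃ ϖ ξ : Fin n → X L, ∀ i,
        MemH1 (ϖ i) ∧ MemLp (ϖ i) ⊤ (vol L) ∧
        (∀ᵐ x ∂(vol L), 1 / τ * (w i x - prev w₀ w i x) - weakDeriv (ϖ i) x
          - ν ^ 2 * weakDeriv (weakDeriv (w i)) x + ξ i x + g (w i x) = Mu * u i x) ∧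
        (∀ᵐ x ∂(vol L),
          ϖ i x ∈ subdiff (fun r : ℝ => ((f ε r : ℝ) : EReal)) (weakDeriv (w i) x)) ∧
        (∀ᵐ x ∂(vol L), ξ i x ∈ Kset K δ (w i x))) ∧
      -- energy inequality; the free energies in it are finite
      (∀ i, freeEnergy ν f Kh G ε δ (prev w₀ w i) ≠ ⊤ ∧
        freeEnergy ν f Kh G ε δ (prev w₀ w i) ≠ ⊥ ∧
        freeEnergy ν f Kh G ε δ (w i) ≠ ⊤ ∧
        freeEnergy ν f Kh G ε δ (w i) ≠ ⊥ ∧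
        1 / (2 * τ) * ‖w i - prev w₀ w i‖ ^ 2
          + (freeEnergy ν f Kh G ε δ (w i)).toReal
          - (freeEnergy ν f Kh G ε δ (prev w₀ w i)).toReal ≤ τ * Mu ^ 2 * ‖u i‖ ^ 2) := by
  have hτ0 : 0 < τ := by rw [hτ]; positivity
  have hCg := hg.Cg_pos
  have hτC : 8 * (Cg + 1) * τ < 1 := by
    rw [lt_div_iff₀ (by positivity)] at hτ'
    linarith
  -- The bound on `τ` enters in two forms: this one for the energy inequality, the next for
  -- solvability and uniqueness.
  have hCτ : 2 * Cg * τ ≤ 1 := by nlinarith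
  have hC1 : Cg < 1 / τ := by
    rw [lt_div_iff₀ hτ0]
    nlinarith
  refine ⟨existsUnique_of_step (S := IsStep τ ν Mu f K g ε δ) u w₀
    (fun u v => exists_isStep hL hν hf hg hK hε hδ hC1 u v)
    (fun u v w w' h h' => h.unique hL hg hK hδ hC1 h'), fun w hw => ?_⟩
  have hstep : ∀ i, IsStep τ ν Mu f K g ε δ (u i) (prev w₀ w i) (w i) := hw
  have hreg := fun i => (hstep i).regularity hL hν hf hg hε
  -- Finite energy of each predecessor is propagated from `w₀` by induction.
  have hprev : ∀ k (h : k < n), MemH1 (prev w₀ w ⟨k, h⟩) ∧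
      InL1 (KhatE Kh δ) (prev w₀ w ⟨k, h⟩) := by
    intro k
    induction k with
    | zero => exact fun h => ⟨hw₀, hKw₀⟩
    | succ k ih =>
      intro h
      obtain ⟨h1, h2⟩ := ih (Nat.lt_of_succ_lt h)
      have h3 := hstep ⟨k, Nat.lt_of_succ_lt h⟩
      rw [prev_succ]
      exact ⟨h3.1, (h3.energy_le hL hf hε hg hK hδ hτ0 hCτ h1 h2).1⟩
  choose ϖ ξ hϖξ using fun i => (hreg i).2
  exact ⟨fun i => (hreg i).1, ⟨ϖ, ξ, hϖξ⟩, fun i =>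
    ((hstep i).energy_le hL hf hε hg hK hδ hτ0 hCτ (hprev i i.2).1 (hprev i i.2).2).2⟩
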